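/- Let $\Lambda=(a,b)$ be a bounded interval of length $l(\Lambda)=b-a>0$, let $\alpha,\beta>0$, and write $\mathbb{H}=L^2(\Lambda;\mathbb{R}^3)$, $\mathbb{H}^1=H^1(\Lambda;\mathbb{R}^3)$ with $|u|_{\mathbb{H}^1}^2=|u|_{\mathbb{H}}^2+|Du|_{\mathbb{H}}^2$. Call $k>0$ admissible if $$\sup_{x\in\Lambda}|u(x)|\le k\,|u|_{\mathbb{H}}^{1/2}|u|_{\mathbb{H}^1}^{1/2}\qquad\text{for all }u\in\mathbb{H}^1 .$$ For a constant $\mathcal K\in\mathbb{R}^3$ and $u_0\in\mathbb{H}^1$ with $|u_0(x)|=1$ on $\Lambda$, consider the Landau–Lifshitz equation $$\frac{dy}{dt}=y\times\bigl(\Delta y-\beta(0,y_2,y_3)^{\mathrm T}+\mathcal K\bigr)-\alpha\,y\times\Bigl(y\times\bigl(\Delta y-\beta(0,y_2,y_3)^{\mathrm T}+\mathcal K\bigr)\Bigr),\qquad y(0)=u_0,$$ with boundary condition $Dy=0$ on $\partial\Lambda$. A solution is a function $y\in C([0,\infty);\mathbb{H})$ with values in $\mathbb{H}^1$, bounded in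 $\mathbb{H}^1$ on bounded time intervals, with $|y(t)(x)|=1$ on $\Lambda$ for all $t\ge0$ and $y\times\Delta y\in L^2(0,T;\mathbb{H})$ for all $T>0$, which satisfies the time-integrated equation in the dual space $(\mathbb{H}^1)'$ for all $t\ge 0$. Here, for $z,w,v,\varphi\in\mathbb{H}^1$, $$\langle w\times\Delta v,\varphi\rangle:=-\langle D(\varphi\times w),Dv\rangle_{\mathbb{H}},\qquad \langle z\times(w\times\Delta v),\varphi\rangle:=-\langle D((\varphi\times z)\times w),Dv\rangle_{\mathbb{H}} .$$ Then $k=2\max\{1,1/\sqrt{l(\Lambda)}\}$ is admissible. Moreover, let $k$ be any admissible constant, let $\mathcal H=(\mathcal H_1,\mathcal H_2,\mathcal H_3)^{\mathrm T}\in\mathbb{R}^3$ satisfy $$|\mathcal H|>\max\Bigl\{\frac{4\beta+4\alpha\beta}{3\alpha},\ \frac{2\beta+4\alpha\beta-\alpha}{\alpha}\Bigr\},$$ let the applied field be $\mathcal K=\mathcal H+\frac{\beta}{|\mathcal H|}(0,\mathcal H_2,\mathcal H_3)^{\mathrm T}$, and suppose that $\bigl|u_0-\tfrac{\mathcal H}{|\mathcal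 H|}\bigr|_{\mathbb{H}^1}<\frac1k$. Then $$\gamma:=\min\Bigl\{\alpha|\mathcal H|+\alpha-2\beta-4\alpha\beta,\ \tfrac32\alpha|\mathcal H|-2\beta-2\alpha\beta\Bigr\}>0,$$ every solution $y$ satisfies $$\Bigl|y(t)-\frac{\mathcal H}{|\mathcal H|}\Bigr|_{\mathbb{H}^1}\le\Bigl|u_0-\frac{\mathcal H}{|\mathcal H|}\Bigr|_{\mathbb{H}^1}e^{-\frac12\gamma t}\qquad\text{for all }t\ge0,$$ and consequently $y(t)\to\frac{\mathcal H}{|\mathcal H|}$ in $\mathbb{H}^1$ as $t\to\infty$. -/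

import Mathlib

open MeasureTheory Set Filter Topology

noncomputable section

namespace LandauLifshitz

/-- Three-dimensional Euclidean space. -/
abbrev R3 := EuclideanSpace ℝ (Fin 3)

/-- The vector product on Euclidean space. -/
def cross (v w : R3) : R3 := WithLp.toLp 2 (crossProduct v.ofLp w.ofLp)

/-- The projection `(v₁, v₂, v₃) ↦ (0, v₂, v₃)`. -/
def transverse (v : R3) : R3 := !₂[0, v 1, v 2]

/-- Lebesgue measure on the interval `Λ = (a, b)`. -/
abbrev intervalMeasure (a b : ℝ) : Measure ℝ := volume.restrict (Ioo a b)

/-- The Hilbert space `ℍ = L²(Λ; ℝ³)`, with `Λ = (a, b)`. -/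
abbrev L2 (a b : ℝ) := Lp R3 2 (intervalMeasure a b)

/-- `v` is a weak (distributional) derivative of `u` on `(a, b)`, and it is square integrable. -/
def IsWeakDeriv (a b : ℝ) (u v : ℝ → R3) : Prop :=
  MemLp v 2 (intervalMeasure a b) ∧
    ∀ φ : ℝ → ℝ, ContDiff ℝ ((⊤ : ℕ∞) : WithTop ℕ∞) φ → HasCompactSupport φ →
      tsupport φ ⊆ Ioo a b →
        ∫ x in Ioo a b, deriv φ x • u x = - ∫ x in Ioo a b, φ x • v x

/-- `u` represents an element of the Sobolev space `ℍ¹ = H¹(Λ; ℝ³)`. -/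
def MemH1 (a b : ℝ) (u : ℝ → R3) : Prop :=
  MemLp u 2 (intervalMeasure a b) ∧ ∃ v, IsWeakDeriv a b u v

open Classical in
/-- The weak derivative `D u` (unique up to a null set when it exists; zero by convention when
`u` has no square integrable weak derivative). -/
def weakDeriv (a b : ℝ) (u : ℝ → R3) : ℝ → R3 :=
  if h : ∃ v, IsWeakDeriv a b u v then h.choose else 0

/-- The norm of `ℍ`, for square integrable `u`. -/
def normL2 (a b : ℝ) (u : ℝ → R3) : ℝ :=
  √(∫ x in Ioo a b, ‖u x‖ ^ 2)

/-- The norm of `ℍ¹`, for `u` in `ℍ¹`. -/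
def normH1 (a b : ℝ) (u : ℝ → R3) : ℝ :=
  √((∫ x in Ioo a b, ‖u x‖ ^ 2) + ∫ x in Ioo a b, ‖weakDeriv a b u x‖ ^ 2)

/-- `k` is a positive constant with `sup_Λ |u| ≤ k |u|_ℍ^{1/2} |u|_{ℍ¹}^{1/2}` for all `u ∈ ℍ¹`.
Elements of `ℍ¹` are given up to null sets here; the essential supremum is the supremum of the
continuous representative. -/
def IsInterpolationConstant (a b k : ℝ) : Prop :=
  0 < k ∧ ∀ u : ℝ → R3, MemH1 a b u →
    ∀ᵐ x ∂(intervalMeasure a b), ‖u x‖ ≤ k * √(normL2 a b u) * √(normH1 a b u)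

/-- The pairing of `w × Δv ∈ (ℍ¹)'` with `φ ∈ ℍ¹`, for `w, v ∈ ℍ¹`:
`⟨w × Δv, φ⟩ = -⟨D(φ × w), D v⟩_ℍ`. -/
def crossLaplacian (a b : ℝ) (w v φ : ℝ → R3) : ℝ :=
  - ∫ x in Ioo a b, inner ℝ (weakDeriv a b (fun x' => cross (φ x') (w x')) x) (weakDeriv a b v x)

/-- The pairing of `z × (w × Δv) ∈ (ℍ¹)'` with `φ ∈ ℍ¹`, for `z, w, v ∈ ℍ¹`:
`⟨z × (w × Δv), φ⟩ = -⟨D((φ × z) × w), D v⟩_ℍ`. -/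
def crossCrossLaplacian (a b : ℝ) (z w v φ : ℝ → R3) : ℝ :=
  - ∫ x in Ioo a b,
      inner ℝ (weakDeriv a b (fun x' => cross (cross (φ x') (z x')) (w x')) x) (weakDeriv a b v x)

/-- The part `-β (0, v₂, v₃) + K` of the effective field that does not contain derivatives. -/
def lowerField (β : ℝ) (K v : R3) : R3 := -(β • transverse v) + K

/-- `y : [0, ∞) → ℍ` is a solution, with initial state `u₀` and constant applied field `K`, of
`dy/dt = y × (Δy - β (0, y₂, y₃) + K) - α y × (y × (Δy - β (0, y₂, y₃) + K))`, `y(0) = u₀`,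
with the boundary condition `D y = 0` on `∂Λ`.
The equation is the integrated one in the dual space of `ℍ¹`; since the test functions are not
required to vanish on `∂Λ`, it contains the boundary condition in the weak sense. The values of
`y` for negative times are irrelevant. -/
structure IsSolution (a b α β : ℝ) (K : R3) (u₀ : ℝ → R3) (y : ℝ → L2 a b) : Prop where
  /-- `y` is continuous with values in `ℍ`. -/
  continuousOn : ContinuousOn y (Ici 0)
  /-- `y` takes values in `ℍ¹`. -/
  memH1 : ∀ t, 0 ≤ t → MemH1 a b (y t)
  /-- `y` is bounded in `ℍ¹` on bounded time intervals. -/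
  bounded : ∀ T : ℝ, ∃ C : ℝ, ∀ t ∈ Icc 0 T, normH1 a b (y t) ≤ C
  /-- The magnetization is saturated: `|y(t)(x)| = 1`. -/
  saturated : ∀ t, 0 ≤ t → ∀ᵐ x ∂(intervalMeasure a b), ‖y t x‖ = 1
  /-- `y × Δy` belongs to `L²(0, T; ℍ)` for every `T`. -/
  sq_integrable : ∃ g : ℝ → L2 a b,
    (∀ T : ℝ, MemLp g 2 (volume.restrict (Ioc 0 T))) ∧
      ∀ᵐ s ∂(volume.restrict (Ioi (0 : ℝ))), ∀ φ : ℝ → R3, MemH1 a b φ →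
        crossLaplacian a b (y s) (y s) φ = ∫ x in Ioo a b, inner ℝ (g s x) (φ x)
  /-- The equation, tested with an arbitrary `φ ∈ ℍ¹`. -/
  equation : ∀ t, 0 ≤ t → ∀ φ : ℝ → R3, MemH1 a b φ →
    ∫ x in Ioo a b, inner ℝ (y t x) (φ x) =
      (∫ x in Ioo a b, inner ℝ (u₀ x) (φ x)) +
      ∫ s in (0 : ℝ)..t,
        ((crossLaplacian a b (y s) (y s) φ +
            ∫ x in Ioo a b, inner ℝ (cross (y s x) (lowerField β K (y s x))) (φ x)) -
          α * (crossCrossLaplacian a b (y s) (y s) (y s) φ +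
            ∫ x in Ioo a b,
              inner ℝ (cross (y s x) (cross (y s x) (lowerField β K (y s x)))) (φ x)))

/-- The rate `γ = (α|H| + α - 2β - 4αβ) ∧ (3/2 α|H| - 2β - 2αβ)`. -/
def decayRate (α β : ℝ) (H : R3) : ℝ :=
  min (α * ‖H‖ + α - 2 * β - 4 * α * β) (3 / 2 * α * ‖H‖ - 2 * β - 2 * α * β)

/-- The applied field `H + (β/|H|) (0, H₂, H₃)`. -/
def appliedField (β : ℝ) (H : R3) : R3 := H + (β / ‖H‖) • transverse H

end LandauLifshitz

end

/-!
A unit vector field `y` near the constant `ζ = H / |H|` is driven towards `ζ` by the damping term of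
the Landau–Lifshitz equation. Write `z = y - ζ`. With the applied field chosen here, the effective
field is `Δy + H - β Q z`, with `Q` the projection `transverse`. Testing the equation with `ζ` and
with `-Δy` gives a differential inequality `d/dt |z|²_{ℍ¹} ≤ -γ |z|²_{ℍ¹}`, whose decisive terms are
`α |H| ∫ |y × ζ|²` and `α |H| ∫ (y · ζ) |Dy|²`; both are coercive where `|z| ≤ 1`, since then
`y · ζ = 1 - |z|² / 2 ≥ 1 / 2` and `|y × ζ|² ≥ 3 / 4 |z|²` (`dissipation_pointwise`, `dissipation`).
The interpolation inequality ensures `|z| ≤ 1` as long as `|z|_{ℍ¹} < 1 / k`, and the decay itself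
preserves this smallness (`decay_of_local_decay`).

The formal computation has to be justified for solutions that are only known to satisfy the
integrated equation in the dual of `ℍ¹`. There are two points.

* Regularity in space. The square integrable field `g = y × Δy` determines the Laplacian,
  `Δy = g × y - |Dy|² y`, because `|y| = 1` (`isNeumannLaplacian_recoveredLaplacian`). A priori this
  is only integrable, but then `Dy` is bounded, and so `Δy` is square integrable, with
  `|Δy|²_ℍ` controlled by `1 + |g|²_ℍ` (`memLp_recoveredLaplacian`). Hence at almost every time the
  right hand side of the equation is a function in `ℍ` (`IsSolution.exists_laplacian`).
* Regularity in time. The coefficients of `y` in the Neumann eigenbasis are absolutely continuous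
  functions of time, and `|Dy|²_ℍ` is a series in their squares by Parseval's identity; summing the
  product rule over the modes gives the energy identity (`energy_identity`). It holds from the
  initial time on, although `Δy(0)` need not be square integrable.

Elements of `H¹` of the interval are handled through their absolutely continuous representatives
(`HasH1Deriv`), for which the product rule and integration by parts are available.
-/

open MeasureTheory Set Filter Topology

noncomputable section

namespace LandauLifshitz

/-! ### Sobolev functions on an interval -/

section

/-- `f'` is the derivative of `f` in `H¹(a, b)`, for scalar functions: `f` agrees almost everywhere
with an absolutely continuous function whose classical derivative is almost everywhere the square
integrable function `f'`. -/
def HasH1Deriv (a b : ℝ) (f f' : ℝ → ℝ) : Prop :=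
  MemLp f' 2 (intervalMeasure a b) ∧
    ∃ F : ℝ → ℝ, AbsolutelyContinuousOnInterval F a b ∧ f =ᵐ[intervalMeasure a b] F ∧
      ∀ᵐ x ∂(intervalMeasure a b), HasDerivAt F (f' x) x

variable {a b : ℝ} {f f' g g' : ℝ → ℝ}

lemma intervalIntegrable_of_memLp (hab : a ≤ b) (hf : MemLp f 2 (intervalMeasure a b)) :
    IntervalIntegrable f volume a b := by
  rw [intervalIntegrable_iff_integrableOn_Ioo_of_le hab]
  exact hf.integrable (by norm_num)

lemma integral_Ioo_eq_interval {E : Type*} [NormedAddCommGroup E] [NormedSpace ℝ E]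
    (hab : a ≤ b) (f : ℝ → E) :
    ∫ x in Ioo a b, f x = ∫ x in a..b, f x := by
  rw [intervalIntegral.integral_of_le hab, integral_Ioc_eq_integral_Ioo]

lemma memLp_of_continuousOn (hf : ContinuousOn f (Icc a b)) (p : ENNReal) :
    MemLp f p (intervalMeasure a b) := by
  obtain ⟨C, hC⟩ := isCompact_Icc.exists_bound_of_continuousOn hf
  refine MemLp.of_bound ((hf.mono Ioo_subset_Icc_self).aestronglyMeasurable measurableSet_Ioo) C ?_
  filter_upwards [ae_restrict_mem measurableSet_Ioo] with x hx using hC x (Ioo_subset_Icc_self hx)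

lemma memLp_bdd_mul (hf : ContinuousOn f (Icc a b)) (hg : MemLp g 2 (intervalMeasure a b)) :
    MemLp (fun x => f x * g x) 2 (intervalMeasure a b) := by
  obtain ⟨C, hC⟩ := isCompact_Icc.exists_bound_of_continuousOn hf
  refine MemLp.of_le_mul (c := C) hg
    (((hf.mono Ioo_subset_Icc_self).aestronglyMeasurable measurableSet_Ioo).mul hg.1) ?_
  filter_upwards [ae_restrict_mem measurableSet_Ioo] with x hx
  rw [norm_mul]
  exact mul_le_mul_of_nonneg_right (hC x (Ioo_subset_Icc_self hx)) (norm_nonneg _)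

lemma _root_.AbsolutelyContinuousOnInterval.continuousOn_Icc (hab : a ≤ b)
    (hf : AbsolutelyContinuousOnInterval f a b) : ContinuousOn f (Icc a b) := by
  simpa [uIcc_of_le hab] using hf.continuousOn

lemma ae_interval_of_ae_Ioo {p : ℝ → Prop} (hab : a ≤ b)
    (h : ∀ᵐ x ∂(intervalMeasure a b), p x) : ∀ᵐ x, x ∈ uIcc a b → p x := by
  rw [ae_restrict_iff' measurableSet_Ioo] at h
  have h1 : ∀ᵐ x : ℝ, x ≠ a := by simp [ae_iff, measure_singleton]
  have h2 : ∀ᵐ x : ℝ, x ≠ b := by simp [ae_iff, measure_singleton]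
  filter_upwards [h, h1, h2] with x hx hxa hxb hm
  rw [uIcc_of_le hab] at hm
  exact hx ⟨lt_of_le_of_ne hm.1 (Ne.symm hxa), lt_of_le_of_ne hm.2 hxb⟩

/-- Two continuous functions that agree almost everywhere on an open interval agree on its
closure. -/
lemma eqOn_of_ae_eq (hab : a < b) (hf : ContinuousOn f (Icc a b)) (hg : ContinuousOn g (Icc a b))
    (h : f =ᵐ[intervalMeasure a b] g) : EqOn f g (Icc a b) := by
  have h1 : EqOn f g (Ioo a b) :=
    Measure.eqOn_open_of_ae_eq h isOpen_Ioo (hf.mono Ioo_subset_Icc_self)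
      (hg.mono Ioo_subset_Icc_self)
  have := h1.of_subset_closure hf hg Ioo_subset_Icc_self (by rw [closure_Ioo hab.ne])
  exact this

namespace HasH1Deriv

lemma congr (h : HasH1Deriv a b f f') (hg : g =ᵐ[intervalMeasure a b] f)
    (hg' : g' =ᵐ[intervalMeasure a b] f') : HasH1Deriv a b g g' := by
  obtain ⟨h1, F, hF, hfF, hd⟩ := h
  refine ⟨h1.ae_eq hg'.symm, F, hF, hg.trans hfF, ?_⟩
  filter_upwards [hd, hg'] with x hx hx'
  rwa [hx']

lemma memLp_top (hab : a ≤ b) (h : HasH1Deriv a b f f') (p : ENNReal) :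
    MemLp f p (intervalMeasure a b) := by
  obtain ⟨h1, F, hF, hfF, hd⟩ := h
  exact (memLp_of_continuousOn (hF.continuousOn_Icc hab) p).ae_eq hfF.symm

lemma unique (hab : a < b) (h : HasH1Deriv a b f f') (h' : HasH1Deriv a b f g') :
    f' =ᵐ[intervalMeasure a b] g' := by
  obtain ⟨h1, F, hF, hfF, hd⟩ := h
  obtain ⟨h1', G, hG, hfG, hd'⟩ := h'
  have := eqOn_of_ae_eq hab (hF.continuousOn_Icc hab.le) (hG.continuousOn_Icc hab.le)
    (hfF.symm.trans hfG)
  filter_upwards [hd, hd', ae_restrict_mem measurableSet_Ioo] with x hx hx' hm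
  have h3 : F =ᶠ[𝓝 x] G := by
    filter_upwards [isOpen_Ioo.mem_nhds hm] with z hz using this (Ioo_subset_Icc_self hz)
  exact (hx.congr_of_eventuallyEq h3.symm).unique hx'

lemma of_contDiff (hf : ContDiff ℝ 1 f) : HasH1Deriv a b f (deriv f) := by
  refine ⟨memLp_of_continuousOn (hf.continuous_deriv le_rfl).continuousOn 2, f,
    hf.contDiffOn.absolutelyContinuousOnInterval, ae_eq_rfl, ?_⟩
  exact ae_of_all _ fun x => (hf.differentiable one_ne_zero x).hasDerivAt

lemma const (c : ℝ) : HasH1Deriv a b (fun _ => c) (fun _ => 0) := by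
  simpa using of_contDiff (a := a) (b := b) (f := fun _ => c) contDiff_const

lemma add (h : HasH1Deriv a b f f') (h' : HasH1Deriv a b g g') :
    HasH1Deriv a b (fun x => f x + g x) (fun x => f' x + g' x) := by
  obtain ⟨h1, F, hF, hfF, hd⟩ := h
  obtain ⟨h1', G, hG, hfG, hd'⟩ := h'
  refine ⟨h1.add h1', fun x => F x + G x, hF.fun_add hG, hfF.add hfG, ?_⟩
  filter_upwards [hd, hd'] with x hx hx' using hx.add hx'

lemma const_mul (c : ℝ) (h : HasH1Deriv a b f f') :
    HasH1Deriv a b (fun x => c * f x) (fun x => c * f' x) := by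
  obtain ⟨h1, F, hF, hfF, hd⟩ := h
  refine ⟨h1.const_mul c, fun x => c * F x, hF.const_mul c, hfF.fun_comp (c * ·), ?_⟩
  filter_upwards [hd] with x hx using hx.const_mul c

lemma neg (h : HasH1Deriv a b f f') :
    HasH1Deriv a b (fun x => -f x) (fun x => -f' x) := by
  simpa using h.const_mul (-1)

lemma sub (h : HasH1Deriv a b f f') (h' : HasH1Deriv a b g g') :
    HasH1Deriv a b (fun x => f x - g x) (fun x => f' x - g' x) := by
  simpa [sub_eq_add_neg] using h.add h'.neg

/-- The product rule. -/
lemma mul (hab : a ≤ b) (h : HasH1Deriv a b f f') (h' : HasH1Deriv a b g g') :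
    HasH1Deriv a b (fun x => f x * g x) (fun x => f' x * g x + f x * g' x) := by
  obtain ⟨h1, F, hF, hfF, hd⟩ := h
  obtain ⟨h1', G, hG, hfG, hd'⟩ := h'
  have hm : MemLp (fun x => f' x * G x + F x * g' x) 2 (intervalMeasure a b) := by
    refine MemLp.add ?_ (memLp_bdd_mul (hF.continuousOn_Icc hab) h1')
    simpa [mul_comm] using memLp_bdd_mul (hG.continuousOn_Icc hab) h1
  refine ⟨hm.ae_eq ?_, fun x => F x * G x, hF.fun_mul hG, hfF.mul hfG, ?_⟩
  · filter_upwards [hfF, hfG] with x hx hx'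
    rw [hx, hx']
  · filter_upwards [hd, hd', hfF, hfG] with x hx hx' e e'
    rw [e, e']
    exact hx.mul hx'

/-- Integration by parts against a continuously differentiable function. -/
lemma integral_mul_deriv (hab : a < b) (h : HasH1Deriv a b f f') (hg : ContDiff ℝ 1 g)
    (hga : g a = 0) (hgb : g b = 0) :
    ∫ x in Ioo a b, f x * deriv g x = - ∫ x in Ioo a b, f' x * g x := by
  obtain ⟨h1, F, hF, hfF, hd⟩ := h
  have key := hF.integral_mul_deriv_eq_deriv_mul (hg.contDiffOn.absolutelyContinuousOnInterval)
  rw [hga, hgb, ← integral_Ioo_eq_interval hab.le, ← integral_Ioo_eq_interval hab.le] at key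
  have e1 : ∫ x in Ioo a b, f x * deriv g x = ∫ x in Ioo a b, F x * deriv g x := by
    refine integral_congr_ae ?_
    filter_upwards [hfF] with x hx
    rw [hx]
  have e2 : ∫ x in Ioo a b, f' x * g x = ∫ x in Ioo a b, deriv F x * g x := by
    refine integral_congr_ae ?_
    filter_upwards [hd] with x hx
    rw [hx.deriv]
  rw [e1, e2, key]
  ring

/-- The primitive of a square integrable function, with any prescribed additive constant. -/
lemma of_primitive (hab : a ≤ b) (hf : MemLp f' 2 (intervalMeasure a b)) (d c : ℝ)
    (hd : d ∈ Icc a b) : HasH1Deriv a b (fun x => c + ∫ t in d..x, f' t) f' := by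
  have hi := intervalIntegrable_of_memLp hab hf
  have hd' : d ∈ uIcc a b := by rwa [uIcc_of_le hab]
  have hac : AbsolutelyContinuousOnInterval (fun x => c + ∫ t in d..x, f' t) a b :=
    ((contDiff_const (c := c) (n := 1)).contDiffOn.absolutelyContinuousOnInterval).fun_add
      (hi.absolutelyContinuousOnInterval_intervalIntegral hd')
  refine ⟨hf, _, hac, ae_eq_rfl, ?_⟩
  rw [ae_restrict_iff' measurableSet_Ioo]
  filter_upwards [hi.ae_hasDerivAt_integral] with x hx hm
  have := hx (by rw [uIcc_of_le hab]; exact Ioo_subset_Icc_self hm) d hd'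
  simpa using this.const_add c

/-- The fundamental theorem of calculus for the continuous representative. -/
lemma exists_rep (hab : a ≤ b) (h : HasH1Deriv a b f f') :
    ∃ F : ℝ → ℝ, ContinuousOn F (Icc a b) ∧ f =ᵐ[intervalMeasure a b] F ∧
      ∀ x ∈ Icc a b, ∀ z ∈ Icc a b, F x - F z = ∫ t in z..x, f' t := by
  obtain ⟨h1, F, hF, hfF, hd⟩ := h
  refine ⟨F, hF.continuousOn_Icc hab, hfF, fun x hx z hz => ?_⟩
  have hsub : uIcc z x ⊆ uIcc a b := by
    rw [uIcc_of_le hab]; exact uIcc_subset_Icc hz hx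
  rw [← (hF.mono hsub).integral_deriv_eq_sub]
  refine intervalIntegral.integral_congr_ae ?_
  filter_upwards [ae_interval_of_ae_Ioo hab hd] with t ht hm
  exact (ht (hsub (uIoc_subset_uIcc hm))).deriv

end HasH1Deriv

/-- Du Bois-Reymond: a function with vanishing distributional derivative is constant. -/
lemma ae_eq_const_of_integral_deriv_eq_zero (hab : a < b)
    (hf : Integrable f (intervalMeasure a b))
    (h : ∀ φ : ℝ → ℝ, ContDiff ℝ ((⊤ : ℕ∞) : WithTop ℕ∞) φ → HasCompactSupport φ →
      tsupport φ ⊆ Ioo a b → ∫ x in Ioo a b, deriv φ x * f x = 0) :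
    ∃ c, ∀ᵐ x ∂(intervalMeasure a b), f x = c := by
  obtain ⟨x₀, hx₀⟩ : ∃ x₀, x₀ ∈ Ioo a b := ⟨(a + b) / 2, by constructor <;> linarith⟩
  obtain ⟨r, hr, hball⟩ := Metric.isOpen_iff.mp isOpen_Ioo x₀ hx₀
  let B : ContDiffBump x₀ := ⟨r / 4, r / 2, by positivity, by linarith⟩
  set ρ : ℝ → ℝ := B.normed volume with hρ
  have hρs : ContDiff ℝ ((⊤ : ℕ∞) : WithTop ℕ∞) ρ := B.contDiff_normed
  have hρc : HasCompactSupport ρ := B.hasCompactSupport_normed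
  have hρt : tsupport ρ ⊆ Ioo a b := by
    rw [hρ, B.tsupport_normed_eq]
    exact (Metric.closedBall_subset_ball (show r / 2 < r by linarith)).trans hball
  have hρi : ∫ x, ρ x = 1 := B.integral_normed
  have hρn : (tsupport ρ).Nonempty := by
    rw [hρ, B.tsupport_normed_eq]
    exact ⟨x₀, Metric.mem_closedBall_self B.rOut_pos.le⟩
  refine ⟨∫ x in Ioo a b, ρ x * f x, ?_⟩
  set c := ∫ x in Ioo a b, ρ x * f x with hc
  have hbdd : ∀ φ : ℝ → ℝ, Continuous φ →
      Integrable (fun x => φ x * f x) (intervalMeasure a b) := by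
    intro φ hφ
    obtain ⟨C, hC⟩ := isCompact_Icc.exists_bound_of_continuousOn (hφ.continuousOn (s := Icc a b))
    refine hf.bdd_mul (c := C) hφ.aestronglyMeasurable ?_
    filter_upwards [ae_restrict_mem measurableSet_Ioo] with x hx using hC x (Ioo_subset_Icc_self hx)
  -- subtracting a multiple of `ρ` makes the integral of `φ` vanish, so that the difference is the
  -- derivative of a test function
  have main : ∀ φ : ℝ → ℝ, ContDiff ℝ ((⊤ : ℕ∞) : WithTop ℕ∞) φ → HasCompactSupport φ →
      tsupport φ ⊆ Ioo a b → ∫ x, φ x • (f x - c) = 0 := by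
    intro φ hφ hφc hφt
    set m := ∫ x, φ x with hm
    set h₀ : ℝ → ℝ := fun x => φ x - m * ρ x with hh₀
    have h₀s : ContDiff ℝ ((⊤ : ℕ∞) : WithTop ℕ∞) h₀ := hφ.sub (contDiff_const.mul hρs)
    set K := tsupport φ ∪ tsupport ρ with hK
    have hKc : IsCompact K := hφc.isCompact.union hρc.isCompact
    have hKn : K.Nonempty := hρn.mono subset_union_right
    have hKab : K ⊆ Ioo a b := union_subset hφt hρt
    have hzero : ∀ x, x ∉ K → h₀ x = 0 := by
      intro x hx
      have h1 : φ x = 0 := image_eq_zero_of_notMem_tsupport fun h => hx (Or.inl h)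
      have h2 : ρ x = 0 := image_eq_zero_of_notMem_tsupport fun h => hx (Or.inr h)
      simp [hh₀, h1, h2]
    obtain ⟨p, hpK, hp⟩ := hKc.exists_isLeast hKn
    obtain ⟨q, hqK, hq⟩ := hKc.exists_isGreatest hKn
    have hint : ∫ x, h₀ x = 0 := by
      have i1 : Integrable φ := hφ.continuous.integrable_of_hasCompactSupport hφc
      have i2 : Integrable ρ := hρs.continuous.integrable_of_hasCompactSupport hρc
      rw [hh₀, integral_sub i1 (i2.const_mul m), integral_const_mul, hρi, ← hm]
      ring
    set ψ : ℝ → ℝ := fun x => ∫ t in a..x, h₀ t with hψ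
    have hψd : ∀ x, HasDerivAt ψ (h₀ x) x := fun x =>
      intervalIntegral.integral_hasDerivAt_right (h₀s.continuous.intervalIntegrable _ _)
        (h₀s.continuous.stronglyMeasurableAtFilter _ _) h₀s.continuous.continuousAt
    have hψ' : deriv ψ = h₀ := funext fun x => (hψd x).deriv
    have hψs : ContDiff ℝ ((⊤ : ℕ∞) : WithTop ℕ∞) ψ := by
      rw [contDiff_infty_iff_deriv]
      exact ⟨fun x => (hψd x).differentiableAt, by rw [hψ']; exact h₀s⟩
    have hsupp : Function.support ψ ⊆ Icc p q := by
      intro x hx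
      by_contra hn
      apply hx
      rw [mem_Icc, not_and_or, not_le, not_le] at hn
      rcases hn with hn | hn
      · have : ∫ t in a..x, h₀ t = ∫ t in a..x, (0 : ℝ) := by
          refine intervalIntegral.integral_congr fun t ht => hzero t fun htK => ?_
          have h1 := hp htK
          have h2 := ht.2
          have h3 := (hKab hpK).1
          rcases le_max_iff.mp h2 with h | h <;> linarith
        simp [hψ, this]
      · have : Function.support h₀ ⊆ Ioc a x := by
          intro t ht
          have htK : t ∈ K := by
            by_contra hk
            exact ht (hzero t hk)
          exact ⟨(hKab htK).1, (hq htK).trans hn.le⟩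
        simp only [hψ]
        rw [intervalIntegral.integral_eq_integral_of_support_subset this, hint]
    have hts : tsupport ψ ⊆ Icc p q := closure_minimal hsupp isClosed_Icc
    have hψc : HasCompactSupport ψ := isCompact_Icc.of_isClosed_subset (isClosed_tsupport _) hts
    have key := h ψ hψs hψc (hts.trans fun x hx =>
      ⟨(hKab hpK).1.trans_le hx.1, hx.2.trans_lt (hKab hqK).2⟩)
    have e1 : ∫ x in Ioo a b, φ x * f x = m * c := by
      rw [hψ'] at key
      have : ∀ x, h₀ x * f x = φ x * f x - m * (ρ x * f x) := fun x => by simp only [hh₀]; ring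
      simp_rw [this] at key
      rw [integral_sub (hbdd φ hφ.continuous) ((hbdd ρ hρs.continuous).const_mul m),
        integral_const_mul] at key
      linarith
    have e2 : ∫ x in Ioo a b, φ x = m :=
      setIntegral_eq_integral_of_forall_compl_eq_zero fun x hx =>
        image_eq_zero_of_notMem_tsupport fun hh => hx (hφt hh)
    have e3 : ∫ x, φ x • (f x - c) = ∫ x in Ioo a b, φ x • (f x - c) := by
      refine (setIntegral_eq_integral_of_forall_compl_eq_zero fun x hx => ?_).symm
      have : φ x = 0 := image_eq_zero_of_notMem_tsupport fun hh => hx (hφt hh)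
      simp [this]
    have e4 : ∀ x, φ x • (f x - c) = φ x * f x - c * φ x := fun x => by
      rw [smul_eq_mul]; ring
    rw [e3]
    simp_rw [e4]
    rw [integral_sub (hbdd φ hφ.continuous) (((hφ.continuous.integrable_of_hasCompactSupport
      hφc).restrict).const_mul c), integral_const_mul, e1, e2]
    ring
  have hloc : LocallyIntegrableOn (fun x => f x - c) (Ioo a b) volume :=
    IntegrableOn.locallyIntegrableOn (hf.sub (integrable_const c))
  have := isOpen_Ioo.ae_eq_zero_of_integral_contDiff_smul_eq_zero hloc main
  rw [ae_restrict_iff' measurableSet_Ioo]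
  filter_upwards [this] with x hx hm
  linarith [hx hm]

/-- A square integrable weak derivative is the derivative of an absolutely continuous
representative. -/
lemma HasH1Deriv.of_weak (hab : a < b) (hf : MemLp f 2 (intervalMeasure a b))
    (hf' : MemLp f' 2 (intervalMeasure a b))
    (h : ∀ φ : ℝ → ℝ, ContDiff ℝ ((⊤ : ℕ∞) : WithTop ℕ∞) φ → HasCompactSupport φ →
      tsupport φ ⊆ Ioo a b → ∫ x in Ioo a b, deriv φ x * f x = - ∫ x in Ioo a b, φ x * f' x) :
    HasH1Deriv a b f f' := by
  have hP := HasH1Deriv.of_primitive hab.le hf' a 0 (left_mem_Icc.mpr hab.le)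
  set P : ℝ → ℝ := fun x => 0 + ∫ t in a..x, f' t with hPdef
  have hP2 : MemLp P 2 (intervalMeasure a b) := hP.memLp_top hab.le 2
  obtain ⟨c, hc⟩ := ae_eq_const_of_integral_deriv_eq_zero (f := fun x => f x - P x) hab
    ((hf.sub hP2).integrable (by norm_num)) (by
      intro φ hφ hφc hφt
      have hφ1 : ContDiff ℝ 1 φ := hφ.of_le (by exact_mod_cast le_top)
      have e1 := h φ hφ hφc hφt
      have e2 := hP.integral_mul_deriv hab hφ1
        (image_eq_zero_of_notMem_tsupport fun hh => absurd (hφt hh).1 (lt_irrefl _))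
        (image_eq_zero_of_notMem_tsupport fun hh => absurd (hφt hh).2 (lt_irrefl _))
      have i1 : Integrable (fun x => deriv φ x * f x) (intervalMeasure a b) :=
        (memLp_bdd_mul (hφ1.continuous_deriv le_rfl).continuousOn hf).integrable (by norm_num)
      have i2 : Integrable (fun x => deriv φ x * P x) (intervalMeasure a b) :=
        (memLp_bdd_mul (hφ1.continuous_deriv le_rfl).continuousOn hP2).integrable (by norm_num)
      simp_rw [mul_sub]
      rw [integral_sub i1 i2, e1]
      simp_rw [mul_comm (deriv φ _), e2, mul_comm (f' _)]
      ring)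
  refine (hP.add (HasH1Deriv.const c)).congr ?_ (by simp)
  filter_upwards [hc] with x hx
  linarith

end

section

/-! ### Vector algebra -/

@[simp] lemma cross_apply_zero (v w : R3) : cross v w 0 = v 1 * w 2 - v 2 * w 1 := by
  simp [cross, cross_apply]

@[simp] lemma cross_apply_one (v w : R3) : cross v w 1 = v 2 * w 0 - v 0 * w 2 := by
  simp [cross, cross_apply]

@[simp] lemma cross_apply_two (v w : R3) : cross v w 2 = v 0 * w 1 - v 1 * w 0 := by
  simp [cross, cross_apply]

@[simp] lemma transverse_apply_zero (v : R3) : transverse v 0 = 0 := by simp [transverse]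
@[simp] lemma transverse_apply_one (v : R3) : transverse v 1 = v 1 := by simp [transverse]
@[simp] lemma transverse_apply_two (v : R3) : transverse v 2 = v 2 := by simp [transverse]

lemma inner_eq (v w : R3) : inner ℝ v w = v 0 * w 0 + v 1 * w 1 + v 2 * w 2 := by
  simp [PiLp.inner_apply, Fin.sum_univ_three]
  ring

lemma norm_sq_eq (v : R3) : ‖v‖ ^ 2 = v 0 ^ 2 + v 1 ^ 2 + v 2 ^ 2 := by
  rw [EuclideanSpace.real_norm_sq_eq, Fin.sum_univ_three]

lemma r3_ext {v w : R3} (h0 : v 0 = w 0) (h1 : v 1 = w 1) (h2 : v 2 = w 2) : v = w := by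
  ext i
  fin_cases i <;> assumption

/-- Lagrange's identity. -/
lemma norm_cross_sq (v w : R3) : ‖cross v w‖ ^ 2 = ‖v‖ ^ 2 * ‖w‖ ^ 2 - inner ℝ v w ^ 2 := by
  simp only [norm_sq_eq, inner_eq, cross_apply_zero, cross_apply_one, cross_apply_two]
  ring

lemma norm_cross_le (v w : R3) : ‖cross v w‖ ≤ ‖v‖ * ‖w‖ := by
  refine le_of_sq_le_sq ?_ (by positivity)
  rw [norm_cross_sq, mul_pow]
  linarith [sq_nonneg (inner ℝ v w)]

lemma norm_transverse_le (v : R3) : ‖transverse v‖ ≤ ‖v‖ := by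
  refine le_of_sq_le_sq ?_ (norm_nonneg _)
  simp only [norm_sq_eq, transverse_apply_zero, transverse_apply_one, transverse_apply_two]
  nlinarith [sq_nonneg (v 0)]

lemma abs_inner_cross_le (u v w : R3) : |inner ℝ (cross u v) w| ≤ ‖u‖ * ‖v‖ * ‖w‖ :=
  (abs_real_inner_le_norm _ _).trans
    (mul_le_mul_of_nonneg_right (norm_cross_le u v) (norm_nonneg _))

lemma continuous_cross : Continuous fun p : R3 × R3 => cross p.1 p.2 := by
  refine (PiLp.continuous_toLp 2 _).comp (continuous_pi fun i => ?_)
  fin_cases i <;> simp [cross_apply] <;> fun_prop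

lemma continuous_transverse : Continuous transverse := by
  refine (PiLp.continuous_toLp 2 _).comp (continuous_pi fun i => ?_)
  fin_cases i <;> simp <;> fun_prop

variable {a b : ℝ} {u v u' v' : ℝ → R3}

/-! ### Vector functions in `H¹` -/

/-- `u'` is the derivative of `u` in `H¹(a, b; ℝ³)`, componentwise. -/
def HasVecDeriv (a b : ℝ) (u u' : ℝ → R3) : Prop :=
  ∀ i, HasH1Deriv a b (fun x => u x i) (fun x => u' x i)

lemma memLp_vec_iff {p : ENNReal} {μ : Measure ℝ} :
    MemLp u p μ ↔ ∀ i, MemLp (fun x => u x i) p μ := memLp_piLp_iff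

namespace HasVecDeriv

lemma memLp_deriv (h : HasVecDeriv a b u u') : MemLp u' 2 (intervalMeasure a b) :=
  memLp_vec_iff.2 fun i => (h i).1

lemma memLp (hab : a ≤ b) (h : HasVecDeriv a b u u') (p : ENNReal) :
    MemLp u p (intervalMeasure a b) :=
  memLp_vec_iff.2 fun i => (h i).memLp_top hab p

lemma congr (h : HasVecDeriv a b u u') (hv : v =ᵐ[intervalMeasure a b] u)
    (hv' : v' =ᵐ[intervalMeasure a b] u') : HasVecDeriv a b v v' := fun i =>
  (h i).congr (hv.fun_comp fun z : R3 => z i) (hv'.fun_comp fun z : R3 => z i)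

lemma unique (hab : a < b) (h : HasVecDeriv a b u u') (h' : HasVecDeriv a b u v') :
    u' =ᵐ[intervalMeasure a b] v' := by
  have : ∀ᵐ x ∂(intervalMeasure a b), ∀ i, u' x i = v' x i :=
    ae_all_iff.2 fun i => (h i).unique hab (h' i)
  filter_upwards [this] with x hx
  ext i
  exact hx i

lemma const (c : R3) : HasVecDeriv a b (fun _ => c) (fun _ => 0) := fun i => by
  simpa using HasH1Deriv.const (c i)

lemma add (h : HasVecDeriv a b u u') (h' : HasVecDeriv a b v v') :
    HasVecDeriv a b (fun x => u x + v x) (fun x => u' x + v' x) := fun i => (h i).add (h' i)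

lemma sub (h : HasVecDeriv a b u u') (h' : HasVecDeriv a b v v') :
    HasVecDeriv a b (fun x => u x - v x) (fun x => u' x - v' x) := fun i => (h i).sub (h' i)

lemma const_smul (c : ℝ) (h : HasVecDeriv a b u u') :
    HasVecDeriv a b (fun x => c • u x) (fun x => c • u' x) := fun i => (h i).const_mul c

lemma smul {f f' : ℝ → ℝ} (hab : a ≤ b) (hf : HasH1Deriv a b f f') (h : HasVecDeriv a b u u') :
    HasVecDeriv a b (fun x => f x • u x) (fun x => f' x • u x + f x • u' x) :=
  fun i => hf.mul hab (h i)

lemma cross (hab : a ≤ b) (h : HasVecDeriv a b u u') (h' : HasVecDeriv a b v v') :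
    HasVecDeriv a b (fun x => cross (u x) (v x))
      (fun x => LandauLifshitz.cross (u' x) (v x) + LandauLifshitz.cross (u x) (v' x)) := by
  intro i
  fin_cases i
  · refine (((h 1).mul hab (h' 2)).sub ((h 2).mul hab (h' 1))).congr ?_ ?_ <;>
      (refine ae_of_all _ fun x => ?_; simp; try ring)
  · refine (((h 2).mul hab (h' 0)).sub ((h 0).mul hab (h' 2))).congr ?_ ?_ <;>
      (refine ae_of_all _ fun x => ?_; simp; try ring)
  · refine (((h 0).mul hab (h' 1)).sub ((h 1).mul hab (h' 0))).congr ?_ ?_ <;>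
      (refine ae_of_all _ fun x => ?_; simp; try ring)

lemma transverse (h : HasVecDeriv a b u u') :
    HasVecDeriv a b (fun x => transverse (u x)) (fun x => LandauLifshitz.transverse (u' x)) := by
  intro i
  fin_cases i
  · simpa using HasH1Deriv.const 0
  · simpa using h 1
  · simpa using h 2

lemma inner (hab : a ≤ b) (h : HasVecDeriv a b u u') (h' : HasVecDeriv a b v v') :
    HasH1Deriv a b (fun x => inner ℝ (u x) (v x))
      (fun x => Inner.inner ℝ (u' x) (v x) + Inner.inner ℝ (u x) (v' x)) := by
  refine ((((h 0).mul hab (h' 0)).add ((h 1).mul hab (h' 1))).add ((h 2).mul hab (h' 2))).congr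
    ?_ ?_ <;> refine ae_of_all _ fun x => ?_ <;> simp only [inner_eq]
  ring

/-- The `H¹` derivative is a weak derivative. -/
lemma isWeakDeriv (hab : a < b) (h : HasVecDeriv a b u u') : IsWeakDeriv a b u u' := by
  refine ⟨h.memLp_deriv, fun φ hφ hφc hφt => ?_⟩
  have hφ1 : ContDiff ℝ 1 φ := hφ.of_le (by exact_mod_cast le_top)
  have i1 : ∀ i, Integrable (fun x => (deriv φ x • u x) i) (intervalMeasure a b) := fun i => by
    simpa using (memLp_bdd_mul (hφ1.continuous_deriv le_rfl).continuousOn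
      ((h i).memLp_top hab.le 2)).integrable (by norm_num)
  have i2 : ∀ i, Integrable (fun x => (φ x • u' x) i) (intervalMeasure a b) := fun i => by
    simpa using (memLp_bdd_mul hφ1.continuous.continuousOn (h i).1).integrable (by norm_num)
  ext i
  rw [PiLp.neg_apply, eval_integral_piLp i1, eval_integral_piLp i2]
  have := (h i).integral_mul_deriv hab hφ1
    (image_eq_zero_of_notMem_tsupport fun hh => absurd (hφt hh).1 (lt_irrefl _))
    (image_eq_zero_of_notMem_tsupport fun hh => absurd (hφt hh).2 (lt_irrefl _))
  simp only [PiLp.smul_apply, smul_eq_mul]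
  simp_rw [mul_comm (deriv φ _), this, mul_comm (φ _)]

/-- A weak derivative is an `H¹` derivative. -/
lemma of_isWeakDeriv (hab : a < b) (hu : MemLp u 2 (intervalMeasure a b))
    (h : IsWeakDeriv a b u u') : HasVecDeriv a b u u' := by
  intro i
  have hui := memLp_vec_iff.1 hu i
  have hui' := memLp_vec_iff.1 h.1 i
  refine HasH1Deriv.of_weak hab hui hui' fun φ hφ hφc hφt => ?_
  have hφ1 : ContDiff ℝ 1 φ := hφ.of_le (by exact_mod_cast le_top)
  have i1 : ∀ i, Integrable (fun x => (deriv φ x • u x) i) (intervalMeasure a b) := fun i => by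
    simpa using (memLp_bdd_mul (hφ1.continuous_deriv le_rfl).continuousOn
      (memLp_vec_iff.1 hu i)).integrable (by norm_num)
  have i2 : ∀ i, Integrable (fun x => (φ x • u' x) i) (intervalMeasure a b) := fun i => by
    simpa using (memLp_bdd_mul hφ1.continuous.continuousOn
      (memLp_vec_iff.1 h.1 i)).integrable (by norm_num)
  have := congrArg (fun z : R3 => z i) (h.2 φ hφ hφc hφt)
  simp only [PiLp.neg_apply] at this
  rw [eval_integral_piLp i1, eval_integral_piLp i2] at this
  simpa using this

lemma memH1 (hab : a < b) (h : HasVecDeriv a b u u') : MemH1 a b u :=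
  ⟨h.memLp hab.le 2, u', h.isWeakDeriv hab⟩

lemma _root_.LandauLifshitz.MemH1.hasVecDeriv (hab : a < b) (h : MemH1 a b u) :
    HasVecDeriv a b u (weakDeriv a b u) := by
  have h2 := h.2
  refine of_isWeakDeriv hab h.1 ?_
  rw [weakDeriv, dif_pos h2]
  exact h2.choose_spec

lemma weakDeriv_ae_eq (hab : a < b) (h : HasVecDeriv a b u u') :
    weakDeriv a b u =ᵐ[intervalMeasure a b] u' :=
  ((h.memH1 hab).hasVecDeriv hab).unique hab h

end HasVecDeriv

/-! ### Integrals of products -/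

lemma integrable_inner_of_memLp {μ : Measure ℝ} (hu : MemLp u 2 μ) (hv : MemLp v 2 μ) :
    Integrable (fun x => inner ℝ (u x) (v x)) μ := by
  simp_rw [inner_eq]
  have h := fun i => (memLp_vec_iff.1 hu i).integrable_mul (memLp_vec_iff.1 hv i)
  exact ((h 0).add (h 1)).add (h 2)

lemma integrable_norm_sq {μ : Measure ℝ} (hu : MemLp u 2 μ) :
    Integrable (fun x => ‖u x‖ ^ 2) μ := by
  simpa using integrable_inner_of_memLp hu hu

/-- The Cauchy-Schwarz inequality for integrals of norms. -/
lemma integral_norm_mul_norm_le {μ : Measure ℝ} (hu : MemLp u 2 μ) (hv : MemLp v 2 μ) :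
    ∫ x, ‖u x‖ * ‖v x‖ ∂μ ≤ √(∫ x, ‖u x‖ ^ 2 ∂μ) * √(∫ x, ‖v x‖ ^ 2 ∂μ) := by
  have := integral_mul_le_Lp_mul_Lq_of_nonneg (μ := μ) (p := 2) (q := 2)
    (f := fun x => ‖u x‖) (g := fun x => ‖v x‖) Real.HolderConjugate.two_two
    (ae_of_all _ fun _ => norm_nonneg _) (ae_of_all _ fun _ => norm_nonneg _)
    (by simpa using hu.norm) (by simpa using hv.norm)
  simpa [Real.sqrt_eq_rpow] using this

lemma memLp_cross_of_bdd {μ : Measure ℝ} {C : ℝ} (hu : AEStronglyMeasurable u μ)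
    (hC : ∀ᵐ x ∂μ, ‖u x‖ ≤ C) (hv : MemLp v 2 μ) : MemLp (fun x => cross (u x) (v x)) 2 μ := by
  refine MemLp.of_le_mul (c := C) hv
    (continuous_cross.comp_aestronglyMeasurable (hu.prodMk hv.1)) ?_
  filter_upwards [hC] with x hx
  exact (norm_cross_le _ _).trans (mul_le_mul_of_nonneg_right hx (norm_nonneg _))

/-- The squared norm of `ℍ¹`. -/
lemma normH1_sq (u : ℝ → R3) : normH1 a b u ^ 2 =
    (∫ x in Ioo a b, ‖u x‖ ^ 2) + ∫ x in Ioo a b, ‖weakDeriv a b u x‖ ^ 2 :=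
  Real.sq_sqrt (add_nonneg (integral_nonneg fun _ => by positivity)
    (integral_nonneg fun _ => by positivity))

lemma HasVecDeriv.normH1_sq (hab : a < b) (h : HasVecDeriv a b u u') : normH1 a b u ^ 2 =
    (∫ x in Ioo a b, ‖u x‖ ^ 2) + ∫ x in Ioo a b, ‖u' x‖ ^ 2 := by
  rw [LandauLifshitz.normH1_sq]
  congr 1
  refine integral_congr_ae ?_
  filter_upwards [h.weakDeriv_ae_eq hab] with x hx
  rw [hx]

/-! ### The interpolation inequality -/

/-- The interval contributes `2 max (1, l^{-1/2})`: average `|u(x)|² = |u(z)|² + 2 ∫_z^x u · u'`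
over `z`. -/
theorem isInterpolationConstant (hab : a < b) :
    IsInterpolationConstant a b (2 * max 1 (1 / √(b - a))) := by
  refine ⟨by positivity, fun u hu => ?_⟩
  set l := b - a with hl
  have hl0 : 0 < l := sub_pos.2 hab
  have hd := hu.hasVecDeriv hab
  set u' := weakDeriv a b u with hu'
  obtain ⟨F, hFc, hFu, hF⟩ := (hd.inner hab.le hd).exists_rep hab.le
  set A := ∫ x in Ioo a b, ‖u x‖ ^ 2 with hA
  set B := ∫ x in Ioo a b, ‖u' x‖ ^ 2 with hB
  have hA0 : 0 ≤ A := integral_nonneg fun _ => by positivity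
  have hB0 : 0 ≤ B := integral_nonneg fun _ => by positivity
  have hFA : ∫ z in Ioo a b, F z = A := by
    refine integral_congr_ae ?_
    filter_upwards [hFu] with x hx
    rw [← hx, real_inner_self_eq_norm_sq]
  have hint : Integrable (fun x => ‖u x‖ * ‖u' x‖) (intervalMeasure a b) :=
    hu.1.norm.integrable_mul hd.memLp_deriv.norm
  -- the variation of `|u|²` is bounded by the Cauchy-Schwarz inequality
  have hpt : ∀ x ∈ Icc a b, ∀ z ∈ Icc a b, F x ≤ F z + 2 * (√A * √B) := by
    intro x hx z hz
    have h1 := hF x hx z hz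
    have h2 : ‖∫ t in z..x, (inner ℝ (u' t) (u t) + inner ℝ (u t) (u' t))‖ ≤
        ∫ t in Ioo a b, 2 * (‖u t‖ * ‖u' t‖) := by
      refine intervalIntegral.norm_integral_le_integral_norm_uIoc.trans ?_
      have hsub : uIoc z x ⊆ Icc a b := uIoc_subset_uIcc.trans (uIcc_subset_Icc hz hx)
      rw [← integral_Icc_eq_integral_Ioo]
      have hint' : IntegrableOn (fun t => 2 * (‖u t‖ * ‖u' t‖)) (Icc a b) := by
        rw [integrableOn_Icc_iff_integrableOn_Ioo]
        exact hint.const_mul 2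
      have hle : ∀ t, ‖inner ℝ (u' t) (u t) + inner ℝ (u t) (u' t)‖ ≤ 2 * (‖u t‖ * ‖u' t‖) := by
        intro t
        rw [real_inner_comm, ← two_mul, norm_mul]
        have := abs_real_inner_le_norm (u t) (u' t)
        simpa using this
      refine (integral_mono_of_nonneg (ae_of_all _ fun _ => norm_nonneg _)
        (hint'.mono_set hsub) (ae_of_all _ hle)).trans ?_
      exact setIntegral_mono_set hint' (ae_of_all _ fun _ => by positivity)
        (LE.le.eventuallyLE hsub)
    rw [integral_const_mul] at h2
    have h3 := integral_norm_mul_norm_le hu.1 hd.memLp_deriv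
    rw [← h1] at h2
    have := (le_abs_self _).trans h2
    linarith
  have hFx : ∀ x ∈ Icc a b, F x ≤ A / l + 2 * (√A * √B) := by
    intro x hx
    have hFi : Integrable F (intervalMeasure a b) := (memLp_of_continuousOn hFc 1).integrable le_rfl
    have h1 : ∫ z in Ioo a b, F x ≤ ∫ z in Ioo a b, (F z + 2 * (√A * √B)) := by
      refine setIntegral_mono_on (integrable_const _) (hFi.add (integrable_const _))
        measurableSet_Ioo fun z hz => hpt x hx z (Ioo_subset_Icc_self hz)
    rw [integral_add hFi (integrable_const _), hFA] at h1
    simp only [integral_const, MeasurableSet.univ, measureReal_restrict_apply, univ_inter,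
      Real.volume_real_Ioo_of_le hab.le, smul_eq_mul, ← hl] at h1
    rw [div_add' _ _ _ hl0.ne', le_div_iff₀ hl0]
    linarith
  filter_upwards [hFu, ae_restrict_mem measurableSet_Ioo] with x hx hm
  have h1 := hFx x (Ioo_subset_Icc_self hm)
  rw [← hx, real_inner_self_eq_norm_sq] at h1
  refine le_of_sq_le_sq (h1.trans ?_) (by positivity)
  have e1 : normL2 a b u = √A := rfl
  have e2 : normH1 a b u = √(A + B) := rfl
  rw [e1, e2, mul_pow, mul_pow, mul_pow, Real.sq_sqrt (Real.sqrt_nonneg _),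
    Real.sq_sqrt (Real.sqrt_nonneg _)]
  set m := max 1 (1 / √l) with hm'
  have hm1 : 1 ≤ m ^ 2 := by nlinarith [le_max_left 1 (1 / √l)]
  have hm2 : 1 / l ≤ m ^ 2 := by
    have h2 : 1 / √l ≤ m := le_max_right _ _
    have h3 : (1 / √l) ^ 2 = 1 / l := by rw [div_pow, Real.sq_sqrt hl0.le]; norm_num
    rw [← h3]
    exact pow_le_pow_left₀ (by positivity) h2 2
  have hsA : √A * √A = A := Real.mul_self_sqrt hA0
  have hAS : √A ≤ √(A + B) := Real.sqrt_le_sqrt (by linarith)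
  have hBS : √B ≤ √(A + B) := Real.sqrt_le_sqrt (by linarith)
  have i1 : A / l ≤ m ^ 2 * (√A * √(A + B)) := by
    have : A / l = 1 / l * (√A * √A) := by rw [hsA]; ring
    rw [this]
    exact mul_le_mul hm2 (mul_le_mul_of_nonneg_left hAS (Real.sqrt_nonneg _)) (by positivity)
      (by positivity)
  have i2 : √A * √B ≤ m ^ 2 * (√A * √(A + B)) := by
    rw [← one_mul (√A * √B)]
    exact mul_le_mul hm1 (mul_le_mul_of_nonneg_left hBS (Real.sqrt_nonneg _)) (by positivity)
      (by positivity)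
  have i3 : 0 ≤ m ^ 2 * (√A * √(A + B)) := by positivity
  linarith

end

section

variable {a b : ℝ} {u u' w g : ℝ → R3}

/-! ### The Laplacian at a fixed time -/

/-- `w` is the weak Laplacian of a function with derivative `u'`, with homogeneous Neumann boundary
conditions: the test functions need not vanish at `a` and `b`. -/
def IsNeumannLaplacian (a b : ℝ) (u' w : ℝ → R3) : Prop :=
  ∀ ψ ψ' : ℝ → R3, HasVecDeriv a b ψ ψ' →
    ∫ x in Ioo a b, inner ℝ (ψ' x) (u' x) = - ∫ x in Ioo a b, inner ℝ (ψ x) (w x)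

/-- A unit vector field is orthogonal to its derivative. -/
lemma HasVecDeriv.inner_deriv_eq_zero (hab : a < b) (hu : HasVecDeriv a b u u')
    (h1 : ∀ᵐ x ∂(intervalMeasure a b), ‖u x‖ = 1) :
    ∀ᵐ x ∂(intervalMeasure a b), Inner.inner ℝ (u x) (u' x) = 0 := by
  have h2 := hu.inner hab.le hu
  have h3 : HasH1Deriv a b (fun x => Inner.inner ℝ (u x) (u x)) (fun _ => 0) := by
    refine (HasH1Deriv.const 1).congr ?_ ae_eq_rfl
    filter_upwards [h1] with x hx
    rw [real_inner_self_eq_norm_sq, hx, one_pow]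
  filter_upwards [h2.unique hab h3] with x hx
  rw [real_inner_comm] at hx
  linarith

lemma cross_cross_self (u v : R3) :
    cross (cross u v) u = ‖u‖ ^ 2 • v - inner ℝ u v • u := by
  refine r3_ext ?_ ?_ ?_ <;> simp [inner_eq, norm_sq_eq] <;> ring

lemma HasVecDeriv.crossLaplacian_eq {v v' φ w w' : ℝ → R3} (hab : a < b)
    (hv : HasVecDeriv a b v v')
    (hw : HasVecDeriv a b (fun x => LandauLifshitz.cross (φ x) (w x)) w') :
    crossLaplacian a b w v φ = - ∫ x in Ioo a b, Inner.inner ℝ (w' x) (v' x) := by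
  rw [crossLaplacian]
  congr 1
  refine integral_congr_ae ?_
  filter_upwards [hv.weakDeriv_ae_eq hab, hw.weakDeriv_ae_eq hab] with x h1 h2
  rw [h1, h2]

/-- The field `g × u - |u'|² u` that equals `Δu` when `|u| = 1` and `g = u × Δu`. -/
def recoveredLaplacian (u u' g : ℝ → R3) (x : ℝ) : R3 := cross (g x) (u x) - ‖u' x‖ ^ 2 • u x

lemma integrable_recoveredLaplacian (hab : a < b) (hu : HasVecDeriv a b u u')
    (h1 : ∀ᵐ x ∂(intervalMeasure a b), ‖u x‖ = 1) (hg : MemLp g 2 (intervalMeasure a b)) :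
    MemLp (fun x => cross (g x) (u x)) 2 (intervalMeasure a b) ∧
    Integrable (recoveredLaplacian u u' g) (intervalMeasure a b) := by
  have hum := hu.memLp hab.le 2
  have i1 : MemLp (fun x => cross (g x) (u x)) 2 (intervalMeasure a b) := by
    refine MemLp.of_le_mul (c := 1) hg (continuous_cross.comp_aestronglyMeasurable
      (hg.1.prodMk hum.1)) ?_
    filter_upwards [h1] with x hx
    have := norm_cross_le (g x) (u x)
    rw [hx] at this
    linarith
  refine ⟨i1, (i1.integrable (by norm_num)).sub ?_⟩
  refine (integrable_norm_sq hu.memLp_deriv).mono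
    ((hu.memLp_deriv.1.norm.pow 2).smul hum.1) ?_
  filter_upwards [h1] with x hx
  rw [norm_smul, hx, mul_one]

/-- If `y × Δy` is the square integrable field `g`, then `Δy = g × y - |Dy|² y`, tested with `ψ`:
the component of `ψ` orthogonal to `y` is `(y × ψ) × y`. -/
lemma isNeumannLaplacian_recoveredLaplacian (hab : a < b) (hu : HasVecDeriv a b u u')
    (h1 : ∀ᵐ x ∂(intervalMeasure a b), ‖u x‖ = 1) (hg : MemLp g 2 (intervalMeasure a b))
    (heq : ∀ φ : ℝ → R3, MemH1 a b φ →
      crossLaplacian a b u u φ = ∫ x in Ioo a b, inner ℝ (g x) (φ x)) :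
    IsNeumannLaplacian a b u' (recoveredLaplacian u u' g) := by
  intro ψ ψ' hψ
  have horth := hu.inner_deriv_eq_zero hab h1
  have hφ := hu.cross hab.le hψ
  have hT : HasVecDeriv a b (fun x => cross (cross (u x) (ψ x)) (u x)) (fun x => ψ' x -
      ((inner ℝ (u' x) (ψ x) + inner ℝ (u x) (ψ' x)) • u x + inner ℝ (u x) (ψ x) • u' x)) := by
    refine (hψ.sub (HasVecDeriv.smul hab.le (hu.inner hab.le hψ) hu)).congr ?_ ae_eq_rfl
    filter_upwards [h1] with x hx
    rw [cross_cross_self, hx, one_pow, one_smul]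
  have key := heq _ (hφ.memH1 hab)
  rw [hu.crossLaplacian_eq hab hT] at key
  obtain ⟨hg1, -⟩ := integrable_recoveredLaplacian hab hu h1 hg
  have hψm := hψ.memLp hab.le 2
  have iA : Integrable (fun x => inner ℝ (ψ' x) (u' x)) (intervalMeasure a b) :=
    integrable_inner_of_memLp hψ.memLp_deriv hu.memLp_deriv
  have iB : Integrable (fun x => inner ℝ (u x) (ψ x) * ‖u' x‖ ^ 2) (intervalMeasure a b) := by
    obtain ⟨F, hF, hFe, -⟩ := (hu.inner hab.le hψ).exists_rep hab.le
    obtain ⟨C, hC⟩ := isCompact_Icc.exists_bound_of_continuousOn hF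
    refine (integrable_norm_sq hu.memLp_deriv).bdd_mul (c := C)
      ((hu.inner hab.le hψ).memLp_top hab.le 2).1 ?_
    filter_upwards [hFe, ae_restrict_mem measurableSet_Ioo] with x hx hm
    rw [hx]
    exact hC x (Ioo_subset_Icc_self hm)
  have iC : Integrable (fun x => inner ℝ (ψ x) (cross (g x) (u x))) (intervalMeasure a b) :=
    integrable_inner_of_memLp hψm hg1
  -- of the derivative of `(u · ψ) u` only the term `(u · ψ) u'` contributes, as `u ⊥ u'`
  have e1 : ∫ x in Ioo a b, inner ℝ (ψ' x -
      ((inner ℝ (u' x) (ψ x) + inner ℝ (u x) (ψ' x)) • u x + inner ℝ (u x) (ψ x) • u' x)) (u' x) =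
      (∫ x in Ioo a b, inner ℝ (ψ' x) (u' x)) -
        ∫ x in Ioo a b, inner ℝ (u x) (ψ x) * ‖u' x‖ ^ 2 := by
    rw [← integral_sub iA iB]
    refine integral_congr_ae ?_
    filter_upwards [horth] with x hx
    rw [inner_sub_left, inner_add_left, real_inner_smul_left, real_inner_smul_left, hx,
      real_inner_self_eq_norm_sq]
    ring
  have e2 : ∫ x in Ioo a b, inner ℝ (ψ x) (recoveredLaplacian u u' g x) =
      (∫ x in Ioo a b, inner ℝ (ψ x) (cross (g x) (u x))) -
        ∫ x in Ioo a b, inner ℝ (u x) (ψ x) * ‖u' x‖ ^ 2 := by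
    rw [← integral_sub iC iB]
    refine integral_congr_ae (ae_of_all _ fun x => ?_)
    simp only [recoveredLaplacian]
    rw [inner_sub_right, real_inner_smul_right, real_inner_comm (u x) (ψ x)]
    ring
  have e3 : ∫ x in Ioo a b, inner ℝ (g x) (cross (u x) (ψ x)) =
      ∫ x in Ioo a b, inner ℝ (ψ x) (cross (g x) (u x)) := by
    refine integral_congr_ae (ae_of_all _ fun x => ?_)
    simp only [inner_eq, cross_apply_zero, cross_apply_one, cross_apply_two]
    ring
  rw [e1, e3] at key
  rw [e2]
  linarith

/-- A derivative with an integrable Neumann Laplacian `w` is the primitive of `w` that vanishes at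
the left end point. -/
lemma IsNeumannLaplacian.deriv_eq_primitive (hab : a < b) (hu' : MemLp u' 2 (intervalMeasure a b))
    (hw : Integrable w (intervalMeasure a b)) (h : IsNeumannLaplacian a b u' w) (i : Fin 3) :
    ∀ᵐ x ∂(intervalMeasure a b), u' x i = ∫ t in a..x, w t i := by
  have hwi : Integrable (fun x => w x i) (intervalMeasure a b) := integrable_piLp_iff.1 hw i
  have hui : MemLp (fun x => u' x i) 2 (intervalMeasure a b) := memLp_vec_iff.1 hu' i
  have hint : IntervalIntegrable (fun x => w x i) volume a b := by
    rwa [intervalIntegrable_iff_integrableOn_Ioo_of_le hab.le]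
  have hWac := hint.absolutelyContinuousOnInterval_intervalIntegral (c := a) left_mem_uIcc
  set W : ℝ → ℝ := fun x => ∫ t in a..x, w t i with hW
  have hWc := hWac.continuousOn_Icc hab.le
  have hW2 : MemLp W 2 (intervalMeasure a b) := memLp_of_continuousOn hWc 2
  have hWd : ∀ᵐ x ∂(intervalMeasure a b), deriv W x = w x i := by
    rw [ae_restrict_iff' measurableSet_Ioo]
    filter_upwards [hint.ae_hasDerivAt_integral] with x hx hm
    exact (hx (by rw [uIcc_of_le hab.le]; exact Ioo_subset_Icc_self hm) a left_mem_uIcc).deriv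
  have main : ∀ η : ℝ → ℝ, ContDiff ℝ ((⊤ : ℕ∞) : WithTop ℕ∞) η → HasCompactSupport η →
      tsupport η ⊆ Ioo a b → ∫ x, η x • (u' x i - W x) = 0 := by
    intro η hη hηc hηt
    -- `P` vanishes at `b` and `W` at `a`, so integration by parts has no boundary terms
    set P : ℝ → ℝ := fun x => ∫ t in b..x, η t with hP
    have hPd : ∀ x, HasDerivAt P (η x) x := fun x =>
      intervalIntegral.integral_hasDerivAt_right (hη.continuous.intervalIntegrable _ _)
        (hη.continuous.stronglyMeasurableAtFilter _ _) hη.continuous.continuousAt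
    have hP' : deriv P = η := funext fun x => (hPd x).deriv
    have hP1 : ContDiff ℝ 1 P := by
      rw [contDiff_one_iff_deriv]
      exact ⟨fun x => (hPd x).differentiableAt, by rw [hP']; exact hη.continuous⟩
    have hPH : HasH1Deriv a b P η := by
      have := HasH1Deriv.of_contDiff (a := a) (b := b) hP1
      rwa [hP'] at this
    have k1 := h _ _ (HasVecDeriv.smul hab.le hPH
      (HasVecDeriv.const (EuclideanSpace.single i (1 : ℝ))))
    have k2 := hWac.integral_mul_deriv_eq_deriv_mul (hP1.contDiffOn.absolutelyContinuousOnInterval)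
    rw [hP', ← integral_Ioo_eq_interval hab.le, ← integral_Ioo_eq_interval hab.le] at k2
    have z1 : P b = 0 := intervalIntegral.integral_same
    have z2 : W a = 0 := intervalIntegral.integral_same
    rw [z1, z2] at k2
    have e1 : ∫ x in Ioo a b, deriv W x * P x = ∫ x in Ioo a b, P x * w x i := by
      refine integral_congr_ae ?_
      filter_upwards [hWd] with x hx
      rw [hx, mul_comm]
    simp only [smul_zero, add_zero, real_inner_smul_left, EuclideanSpace.inner_single_left,
      map_one, one_mul] at k1
    have e2 : ∫ x, η x • (u' x i - W x) = ∫ x in Ioo a b, η x • (u' x i - W x) := by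
      refine (setIntegral_eq_integral_of_forall_compl_eq_zero fun x hx => ?_).symm
      have : η x = 0 := image_eq_zero_of_notMem_tsupport fun hh => hx (hηt hh)
      simp [this]
    rw [e2]
    simp only [smul_eq_mul, mul_sub]
    rw [integral_sub ((memLp_bdd_mul hη.continuous.continuousOn hui).integrable (by norm_num))
      ((memLp_bdd_mul hη.continuous.continuousOn hW2).integrable (by norm_num)), k1, ← e1]
    simp only [mul_comm (η _)]
    rw [k2]
    ring
  have hloc : LocallyIntegrableOn (fun x => u' x i - W x) (Ioo a b) volume :=
    IntegrableOn.locallyIntegrableOn ((hui.sub hW2).integrable (by norm_num))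
  rw [ae_restrict_iff' measurableSet_Ioo]
  filter_upwards [isOpen_Ioo.ae_eq_zero_of_integral_contDiff_smul_eq_zero hloc main] with x hx hm
  linarith [hx hm]

/-- The recovered Laplacian is square integrable, with a bound by the norms of `Dy` and of
`g = y × Δy`: it is integrable, hence `Dy` is bounded. -/
lemma memLp_recoveredLaplacian (hab : a < b) (hu : HasVecDeriv a b u u')
    (h1 : ∀ᵐ x ∂(intervalMeasure a b), ‖u x‖ = 1) (hg : MemLp g 2 (intervalMeasure a b))
    (heq : ∀ φ : ℝ → R3, MemH1 a b φ →
      crossLaplacian a b u u φ = ∫ x in Ioo a b, inner ℝ (g x) (φ x)) :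
    MemLp (recoveredLaplacian u u' g) 2 (intervalMeasure a b) ∧
    ∫ x in Ioo a b, ‖recoveredLaplacian u u' g x‖ ^ 2 ≤
      2 * (∫ x in Ioo a b, ‖g x‖ ^ 2) + 12 * ((b - a) * (∫ x in Ioo a b, ‖g x‖ ^ 2) +
        (∫ x in Ioo a b, ‖u' x‖ ^ 2) ^ 2) * ∫ x in Ioo a b, ‖u' x‖ ^ 2 := by
  obtain ⟨hg1, hw⟩ := integrable_recoveredLaplacian hab hu h1 hg
  have hN := isNeumannLaplacian_recoveredLaplacian hab hu h1 hg heq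
  have hprim : ∀ᵐ x ∂(intervalMeasure a b), ∀ i, u' x i =
      ∫ t in a..x, recoveredLaplacian u u' g t i :=
    ae_all_iff.2 fun i => hN.deriv_eq_primitive hab hu.memLp_deriv hw i
  set w := recoveredLaplacian u u' g with hwdef
  set M := ∫ x in Ioo a b, ‖w x‖ with hM
  set G := ∫ x in Ioo a b, ‖g x‖ ^ 2 with hG
  set A := ∫ x in Ioo a b, ‖u' x‖ ^ 2 with hA
  have hM0 : 0 ≤ M := integral_nonneg fun _ => norm_nonneg _
  have hA0 : 0 ≤ A := integral_nonneg fun _ => by positivity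
  have hG0 : 0 ≤ G := integral_nonneg fun _ => by positivity
  have hwnorm : ∀ᵐ x ∂(intervalMeasure a b), ‖w x‖ ≤ ‖g x‖ + ‖u' x‖ ^ 2 := by
    filter_upwards [h1] with x hx
    refine (norm_sub_le _ _).trans (add_le_add ?_ ?_)
    · have := norm_cross_le (g x) (u x)
      rwa [hx, mul_one] at this
    · rw [norm_smul, hx, mul_one, Real.norm_of_nonneg (by positivity)]
  -- `M` is the `L¹` norm of the Laplacian, which bounds `u'` because `u'` is its primitive
  have hbound : ∀ᵐ x ∂(intervalMeasure a b), ‖u' x‖ ^ 2 ≤ 3 * M ^ 2 := by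
    filter_upwards [hprim, ae_restrict_mem measurableSet_Ioo] with x hx hm
    have hi : ∀ i, (u' x i) ^ 2 ≤ M ^ 2 := by
      intro i
      rw [← sq_abs]
      refine pow_le_pow_left₀ (abs_nonneg _) ?_ 2
      rw [hx i, ← Real.norm_eq_abs]
      refine intervalIntegral.norm_integral_le_integral_norm_uIoc.trans ?_
      have hsub : uIoc a x ⊆ Ioo a b := by
        rw [uIoc_of_le hm.1.le]
        exact fun t ht => ⟨ht.1, ht.2.trans_lt hm.2⟩
      refine (setIntegral_mono_on ((integrable_piLp_iff.1 hw i).norm.mono_measure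
        (Measure.restrict_mono hsub le_rfl)) (hw.norm.mono_measure
        (Measure.restrict_mono hsub le_rfl)) measurableSet_uIoc
        fun t _ => PiLp.norm_apply_le (w t) i).trans ?_
      exact setIntegral_mono_set hw.norm (ae_of_all _ fun _ => norm_nonneg _)
        (LE.le.eventuallyLE hsub)
    rw [norm_sq_eq]
    linarith [hi 0, hi 1, hi 2]
  have hwsq : ∀ᵐ x ∂(intervalMeasure a b),
      ‖w x‖ ^ 2 ≤ 2 * ‖g x‖ ^ 2 + 6 * M ^ 2 * ‖u' x‖ ^ 2 := by
    filter_upwards [hwnorm, hbound] with x h2 h3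
    have h4 : ‖w x‖ ^ 2 ≤ (‖g x‖ + ‖u' x‖ ^ 2) ^ 2 := pow_le_pow_left₀ (norm_nonneg _) h2 2
    have h5 : (‖u' x‖ ^ 2) * ‖u' x‖ ^ 2 ≤ 3 * M ^ 2 * ‖u' x‖ ^ 2 :=
      mul_le_mul_of_nonneg_right h3 (by positivity)
    nlinarith [sq_nonneg (‖g x‖ - ‖u' x‖ ^ 2)]
  have hint : Integrable (fun x => 2 * ‖g x‖ ^ 2 + 6 * M ^ 2 * ‖u' x‖ ^ 2) (intervalMeasure a b) :=
    ((integrable_norm_sq hg).const_mul 2).add ((integrable_norm_sq hu.memLp_deriv).const_mul _)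
  have hw2 : MemLp w 2 (intervalMeasure a b) := by
    rw [memLp_two_iff_integrable_sq_norm hw.1]
    refine hint.mono' (hw.1.norm.pow 2) ?_
    filter_upwards [hwsq] with x hx
    rwa [Real.norm_of_nonneg (by positivity)]
  refine ⟨hw2, ?_⟩
  have k1 : ∫ x in Ioo a b, ‖w x‖ ^ 2 ≤ 2 * G + 6 * M ^ 2 * A := by
    refine (integral_mono_ae (integrable_norm_sq hw2) hint hwsq).trans_eq ?_
    rw [integral_add ((integrable_norm_sq hg).const_mul 2)
      ((integrable_norm_sq hu.memLp_deriv).const_mul _), integral_const_mul, integral_const_mul]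
  have k2 : ∫ x in Ioo a b, ‖g x‖ ≤ √G * √(b - a) := by
    have hc : MemLp (fun _ : ℝ => EuclideanSpace.single (0 : Fin 3) (1 : ℝ)) 2
      (intervalMeasure a b) := memLp_const _
    have := integral_norm_mul_norm_le hg hc
    simpa [Real.volume_real_Ioo_of_le hab.le] using this
  have k3 : M ≤ √G * √(b - a) + A := by
    have hgi : Integrable (fun x => ‖g x‖) (intervalMeasure a b) :=
      (hg.integrable (by norm_num)).norm
    refine (integral_mono_ae hw.norm (hgi.add (integrable_norm_sq hu.memLp_deriv))
      hwnorm).trans ?_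
    simp only [Pi.add_apply]
    rw [integral_add hgi (integrable_norm_sq hu.memLp_deriv)]
    exact add_le_add k2 le_rfl
  have k4 : M ^ 2 ≤ 2 * ((b - a) * G + A ^ 2) := by
    have h2 : M ^ 2 ≤ (√G * √(b - a) + A) ^ 2 := pow_le_pow_left₀ hM0 k3 2
    have h3 : (√G * √(b - a)) ^ 2 = (b - a) * G := by
      rw [mul_pow, Real.sq_sqrt hG0, Real.sq_sqrt (sub_nonneg.2 hab.le)]
      ring
    nlinarith [sq_nonneg (√G * √(b - a) - A)]
  nlinarith [mul_le_mul_of_nonneg_right k4 hA0]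

end

section

variable {a b α β : ℝ} {u u' w g : ℝ → R3}

/-! ### Dissipation at a fixed time -/

/-- The right hand side `u × h - α u × (u × h)` of the equation, for the effective field
`h = w - β (0, u₂, u₃) + K` with `w = Δu`. -/
def rhsField (α β : ℝ) (K u w : R3) : R3 :=
  cross u (w + lowerField β K u) - α • cross u (cross u (w + lowerField β K u))

/-- The correction of the applied field makes `H / |H|` an equilibrium. -/
lemma lowerField_appliedField (β : ℝ) (H v : R3) :
    lowerField β (appliedField β H) v = H - β • transverse (v - ‖H‖⁻¹ • H) := by
  refine r3_ext ?_ ?_ ?_ <;> simp [lowerField, appliedField, div_eq_mul_inv] <;> ring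

lemma norm_lowerField_le (hβ : 0 ≤ β) (K v : R3) : ‖lowerField β K v‖ ≤ β * ‖v‖ + ‖K‖ := by
  refine (norm_add_le _ _).trans (add_le_add ?_ le_rfl)
  rw [norm_neg, norm_smul, Real.norm_of_nonneg hβ]
  exact mul_le_mul_of_nonneg_left (norm_transverse_le v) hβ

lemma continuous_lowerField (β : ℝ) (K : R3) : Continuous (lowerField β K) :=
  (continuous_transverse.const_smul β).neg.add continuous_const

lemma norm_rhsField_le (hα : 0 ≤ α) (hβ : 0 ≤ β) (K : R3) {u : R3} (hu : ‖u‖ = 1) (w : R3) :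
    ‖rhsField α β K u w‖ ≤ (1 + α) * (‖w‖ + (β + ‖K‖)) := by
  have h1 : ‖w + lowerField β K u‖ ≤ ‖w‖ + (β + ‖K‖) := by
    refine (norm_add_le _ _).trans (add_le_add le_rfl ?_)
    simpa [hu] using norm_lowerField_le hβ K u
  have h2 : ‖cross u (w + lowerField β K u)‖ ≤ ‖w‖ + (β + ‖K‖) := by
    refine (norm_cross_le _ _).trans ?_
    rwa [hu, one_mul]
  have h3 : ‖cross u (cross u (w + lowerField β K u))‖ ≤ ‖w‖ + (β + ‖K‖) := by
    refine (norm_cross_le _ _).trans ?_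
    rwa [hu, one_mul]
  refine (norm_sub_le _ _).trans ?_
  rw [norm_smul, Real.norm_of_nonneg hα, add_mul, one_mul]
  exact add_le_add h2 (mul_le_mul_of_nonneg_left h3 hα)

lemma continuous_rhsField (α β : ℝ) (K : R3) :
    Continuous fun p : R3 × R3 => rhsField α β K p.1 p.2 := by
  have h1 : Continuous fun p : R3 × R3 => cross p.1 (p.2 + lowerField β K p.1) :=
    continuous_cross.comp (continuous_fst.prodMk
      (continuous_snd.add ((continuous_lowerField β K).comp continuous_fst)))
  exact h1.sub ((continuous_cross.comp (continuous_fst.prodMk h1)).const_smul α)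

lemma memLp_rhsField (hα : 0 ≤ α) (hβ : 0 ≤ β) (K : R3)
    (hu : AEStronglyMeasurable u (intervalMeasure a b))
    (h1 : ∀ᵐ x ∂(intervalMeasure a b), ‖u x‖ = 1) (hw : MemLp w 2 (intervalMeasure a b)) :
    MemLp (fun x => rhsField α β K (u x) (w x)) 2 (intervalMeasure a b) := by
  have hm : MemLp (fun x => (1 + α) * (‖w x‖ + (β + ‖K‖))) 2 (intervalMeasure a b) :=
    (hw.norm.add (memLp_const (β + ‖K‖))).const_mul (1 + α)
  have hmeas : AEStronglyMeasurable (fun x => rhsField α β K (u x) (w x)) (intervalMeasure a b) :=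
    Continuous.comp_aestronglyMeasurable (g := fun p : R3 × R3 => rhsField α β K p.1 p.2)
      (f := fun x => (u x, w x)) (continuous_rhsField α β K) (hu.prodMk hw.1)
  refine hm.mono hmeas ?_
  filter_upwards [h1] with x hx
  exact (norm_rhsField_le hα hβ K hx _).trans (le_abs_self _)

/-- The terms of the equation with `Δu`, as integrals against the Laplacian `w`. -/
lemma IsNeumannLaplacian.crossLaplacian_eq (hab : a < b) (hu : HasVecDeriv a b u u')
    (hN : IsNeumannLaplacian a b u' w) {φ φ' : ℝ → R3} (hφ : HasVecDeriv a b φ φ') :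
    crossLaplacian a b u u φ = ∫ x in Ioo a b, inner ℝ (cross (u x) (w x)) (φ x) := by
  have h := hφ.cross hab.le hu
  rw [hu.crossLaplacian_eq hab h, hN _ _ h, neg_neg]
  refine integral_congr_ae (ae_of_all _ fun x => ?_)
  simp only [inner_eq, cross_apply_zero, cross_apply_one, cross_apply_two]
  ring

lemma IsNeumannLaplacian.crossCrossLaplacian_eq (hab : a < b) (hu : HasVecDeriv a b u u')
    (hN : IsNeumannLaplacian a b u' w) {φ φ' : ℝ → R3} (hφ : HasVecDeriv a b φ φ') :
    crossCrossLaplacian a b u u u φ =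
      ∫ x in Ioo a b, inner ℝ (cross (u x) (cross (u x) (w x))) (φ x) := by
  have h : crossCrossLaplacian a b u u u φ = crossLaplacian a b u u fun x => cross (φ x) (u x) :=
    rfl
  rw [h, hN.crossLaplacian_eq hab hu (hφ.cross hab.le hu)]
  refine integral_congr_ae (ae_of_all _ fun x => ?_)
  simp only [inner_eq, cross_apply_zero, cross_apply_one, cross_apply_two]
  ring

lemma integral_inner_rhsField (hab : a < b) (hβ : 0 ≤ β) (K : R3) (hu : HasVecDeriv a b u u')
    (h1 : ∀ᵐ x ∂(intervalMeasure a b), ‖u x‖ = 1) (hw : MemLp w 2 (intervalMeasure a b))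
    (hN : IsNeumannLaplacian a b u' w) {φ φ' : ℝ → R3} (hφ : HasVecDeriv a b φ φ') :
    ((crossLaplacian a b u u φ +
      ∫ x in Ioo a b, inner ℝ (cross (u x) (lowerField β K (u x))) (φ x)) -
      α * (crossCrossLaplacian a b u u u φ + ∫ x in Ioo a b,
        inner ℝ (cross (u x) (cross (u x) (lowerField β K (u x)))) (φ x))) =
    ∫ x in Ioo a b, inner ℝ (rhsField α β K (u x) (w x)) (φ x) := by
  have hum := (hu.memLp hab.le 2).1
  have hφ2 := hφ.memLp hab.le 2
  have hle : ∀ᵐ x ∂(intervalMeasure a b), ‖u x‖ ≤ 1 := by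
    filter_upwards [h1] with x hx using hx.le
  have hℓ : MemLp (fun x => lowerField β K (u x)) 2 (intervalMeasure a b) := by
    refine MemLp.of_bound ((continuous_lowerField β K).comp_aestronglyMeasurable hum)
      (β + ‖K‖) ?_
    filter_upwards [h1] with x hx
    simpa [hx] using norm_lowerField_le hβ K (u x)
  have m1 := memLp_cross_of_bdd hum hle hw
  have m2 := memLp_cross_of_bdd hum hle hℓ
  have i1 := integrable_inner_of_memLp m1 hφ2
  have i2 := integrable_inner_of_memLp m2 hφ2
  have i3 := integrable_inner_of_memLp (memLp_cross_of_bdd hum hle m1) hφ2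
  have i4 := integrable_inner_of_memLp (memLp_cross_of_bdd hum hle m2) hφ2
  rw [hN.crossLaplacian_eq hab hu hφ, hN.crossCrossLaplacian_eq hab hu hφ,
    ← integral_add i1 i2, ← integral_add i3 i4, ← integral_const_mul,
    ← integral_sub (i1.fun_add i2) ((i3.fun_add i4).const_mul α)]
  refine integral_congr_ae (ae_of_all _ fun x => ?_)
  simp only [rhsField, inner_eq, cross_apply_zero, cross_apply_one, cross_apply_two, PiLp.add_apply,
    PiLp.sub_apply, PiLp.smul_apply, smul_eq_mul]
  ring

/-- The field tested against the Laplacian in the dissipation estimate, with `l` the part of the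
effective field without derivatives. The first summand comes from the energy `|Du|²`, the second
from `|u - ζ|²`: there the vector products are moved from the Laplacian to `ζ`. -/
def testField (α : ℝ) (ζ u l : R3) : R3 :=
  (cross u l - α • cross u (cross u l)) + (cross ζ u - α • cross (cross ζ u) u)

/-- The derivative of `testField α ζ u l` when `u`, `l` have derivatives `p`, `q`. -/
def testFieldDeriv (α : ℝ) (ζ u l p q : R3) : R3 :=
  ((cross p l + cross u q) - α • (cross p (cross u l) + cross u (cross p l + cross u q))) +
    (cross ζ p - α • (cross (cross ζ p) u + cross (cross ζ u) p))

lemma HasVecDeriv.testField {l q : ℝ → R3} (hab : a ≤ b) (hu : HasVecDeriv a b u u')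
    (hl : HasVecDeriv a b l q) (α : ℝ) (ζ : R3) :
    HasVecDeriv a b (fun x => testField α ζ (u x) (l x))
      (fun x => testFieldDeriv α ζ (u x) (l x) (u' x) (q x)) := by
  have h1 := hu.cross hab hl
  have h2 := hu.cross hab h1
  have h3 := (HasVecDeriv.const ζ).cross hab hu
  have h4 := h3.cross hab hu
  refine ((h1.sub (h2.const_smul α)).add (h3.sub (h4.const_smul α))).congr ae_eq_rfl ?_
  refine ae_of_all _ fun x => ?_
  refine r3_ext ?_ ?_ ?_ <;> simp [testFieldDeriv]

/-- The formal derivative of the energy at a fixed time, with all occurrences of the Laplacian `w`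
collected in one test field; the term quadratic in `w` has a sign. -/
lemma inner_rhsField_testField (K u w ζ : R3) :
    -inner ℝ w (rhsField α β K u w) - inner ℝ (rhsField α β K u w) ζ =
      -inner ℝ w (testField α ζ u (lowerField β K u)) - α * ‖cross u w‖ ^ 2 -
      inner ℝ (cross u (lowerField β K u) - α • cross u (cross u (lowerField β K u))) ζ := by
  unfold rhsField testField
  generalize lowerField β K u = l
  have e1 : inner ℝ w (cross u (w + l)) = inner ℝ w (cross u l) := by
    simp only [inner_eq, cross_apply_zero, cross_apply_one, cross_apply_two,
      PiLp.add_apply]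
    ring
  have e2 : inner ℝ w (cross u (cross u (w + l))) =
      inner ℝ w (cross u (cross u l)) - ‖cross u w‖ ^ 2 := by
    simp only [inner_eq, norm_sq_eq, cross_apply_zero, cross_apply_one, cross_apply_two,
      PiLp.add_apply]
    ring
  have e3 : inner ℝ (cross u (w + l)) ζ = inner ℝ w (cross ζ u) + inner ℝ (cross u l) ζ := by
    simp only [inner_eq, cross_apply_zero, cross_apply_one, cross_apply_two,
      PiLp.add_apply]
    ring
  have e4 : inner ℝ (cross u (cross u (w + l))) ζ =
      inner ℝ w (cross (cross ζ u) u) + inner ℝ (cross u (cross u l)) ζ := by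
    simp only [inner_eq, cross_apply_zero, cross_apply_one, cross_apply_two,
      PiLp.add_apply]
    ring
  simp only [inner_sub_left, inner_sub_right, inner_add_right, real_inner_smul_left,
    real_inner_smul_right, e1, e2, e3, e4]
  ring

/-- The pairing of the derivative of the test field with `p = Du`; the last two terms vanish if `p`
is orthogonal to `u`. -/
lemma inner_testFieldDeriv (α β h : ℝ) (ζ u z p : R3) :
    inner ℝ (testFieldDeriv α ζ u (h • ζ - β • transverse z) p (-(β • transverse p))) p =
      -(β * inner ℝ (cross u (transverse p)) p) -
      α * (h * inner ℝ u ζ - β * inner ℝ u (transverse z)) * ‖p‖ ^ 2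
      - α * β * inner ℝ (cross u (transverse p)) (cross u p) - α * inner ℝ u ζ * ‖p‖ ^ 2 +
      α * inner ℝ u p * inner ℝ (h • ζ - β • transverse z) p +
      α * inner ℝ ζ p * inner ℝ u p := by
  have e0 : inner ℝ u (h • ζ - β • transverse z) =
      h * inner ℝ u ζ - β * inner ℝ u (transverse z) := by
    rw [inner_sub_right, real_inner_smul_right, real_inner_smul_right]
  rw [← e0]
  generalize h • ζ - β • transverse z = l
  generalize transverse p = q
  have e1 : inner ℝ (cross p l) p = 0 := by
    simp only [inner_eq, cross_apply_zero, cross_apply_one, cross_apply_two]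
    ring
  have e2 : inner ℝ (cross u (-(β • q))) p = -(β * inner ℝ (cross u q) p) := by
    simp only [inner_eq, cross_apply_zero, cross_apply_one, cross_apply_two,
      PiLp.neg_apply, PiLp.smul_apply, smul_eq_mul]
    ring
  have e3 : inner ℝ (cross p (cross u l)) p = 0 := by
    simp only [inner_eq, cross_apply_zero, cross_apply_one, cross_apply_two]
    ring
  have e4 : inner ℝ (cross u (cross p l + cross u (-(β • q)))) p =
      inner ℝ u l * ‖p‖ ^ 2 - inner ℝ u p * inner ℝ l p +
        β * inner ℝ (cross u q) (cross u p) := by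
    simp only [inner_eq, norm_sq_eq, cross_apply_zero, cross_apply_one, cross_apply_two,
      PiLp.neg_apply, PiLp.smul_apply, PiLp.add_apply, smul_eq_mul]
    ring
  have e5 : inner ℝ (cross ζ p) p = 0 := by
    simp only [inner_eq, cross_apply_zero, cross_apply_one, cross_apply_two]
    ring
  have e6 : inner ℝ (cross (cross ζ p) u) p =
      inner ℝ u ζ * ‖p‖ ^ 2 - inner ℝ ζ p * inner ℝ u p := by
    simp only [inner_eq, norm_sq_eq, cross_apply_zero, cross_apply_one, cross_apply_two]
    ring
  have e7 : inner ℝ (cross (cross ζ u) p) p = 0 := by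
    simp only [inner_eq, cross_apply_zero, cross_apply_one, cross_apply_two]
    ring
  rw [testFieldDeriv, inner_add_left, inner_sub_left, inner_sub_left, inner_add_left,
    real_inner_smul_left, real_inner_smul_left, inner_add_left, inner_add_left, e1, e2, e3, e4,
    e5, e6, e7]
  ring

lemma inner_lowerOrder (α β h : ℝ) (ζ u z : R3) :
    inner ℝ (cross u (h • ζ - β • transverse z) -
        α • cross u (cross u (h • ζ - β • transverse z))) ζ =
      -(β * inner ℝ (cross u (transverse z)) ζ) + α * h * ‖cross u ζ‖ ^ 2 -
        α * β * inner ℝ (cross u (transverse z)) (cross u ζ) := by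
  generalize transverse z = q
  simp only [inner_eq, norm_sq_eq, cross_apply_zero, cross_apply_one, cross_apply_two,
    PiLp.sub_apply, PiLp.smul_apply, smul_eq_mul]
  ring

/-- The pointwise dissipation estimate, for a unit vector `u`, a vector `p` orthogonal to it (the
derivative of `u`), and `u` at distance at most one from the direction `ζ` of the field. -/
lemma dissipation_pointwise (hα : 0 ≤ α) (hβ : 0 ≤ β) {u p ζ : R3} {h : ℝ} (hh : 0 ≤ h)
    (hu : ‖u‖ = 1) (hup : inner ℝ u p = 0) (hζ : ‖ζ‖ = 1) (hz : ‖u - ζ‖ ≤ 1) :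
    inner ℝ (testFieldDeriv α ζ u (h • ζ - β • transverse (u - ζ)) p (-(β • transverse p))) p -
      inner ℝ (cross u (h • ζ - β • transverse (u - ζ)) -
        α • cross u (cross u (h • ζ - β • transverse (u - ζ)))) ζ ≤
    (β + 2 * α * β - α * h / 2 - α / 2) * ‖p‖ ^ 2 +
      (β + α * β - 3 / 4 * (α * h)) * ‖u - ζ‖ ^ 2 := by
  set z := u - ζ with hzdef
  set s := inner ℝ u ζ with hs
  have hzs : ‖z‖ ^ 2 = 2 - 2 * s := by
    rw [hzdef, norm_sub_sq_real, hu, hζ]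
    ring
  have hz2 : ‖z‖ ^ 2 ≤ 1 := by
    simpa using pow_le_pow_left₀ (norm_nonneg _) hz 2
  have hz0 : 0 ≤ ‖z‖ ^ 2 := by positivity
  -- the bounds for the lower order terms
  have b1 : -inner ℝ (cross u (transverse p)) p ≤ ‖p‖ ^ 2 := by
    have h1 := abs_inner_cross_le u (transverse p) p
    have h2 := mul_le_mul_of_nonneg_right (norm_transverse_le p) (norm_nonneg p)
    rw [hu, one_mul] at h1
    nlinarith [neg_abs_le (inner ℝ (cross u (transverse p)) p)]
  have hcp : ‖cross u (transverse p)‖ ≤ ‖p‖ := by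
    refine (norm_cross_le _ _).trans ?_
    rw [hu, one_mul]
    exact norm_transverse_le p
  have hcp' : ‖cross u p‖ ≤ ‖p‖ := by
    refine (norm_cross_le _ _).trans ?_
    rw [hu, one_mul]
  have b2 : -inner ℝ (cross u (transverse p)) (cross u p) ≤ ‖p‖ ^ 2 := by
    have h1 := abs_real_inner_le_norm (cross u (transverse p)) (cross u p)
    have h2 := mul_le_mul hcp hcp' (norm_nonneg _) (norm_nonneg _)
    nlinarith [neg_abs_le (inner ℝ (cross u (transverse p)) (cross u p))]
  have b3 : inner ℝ u (transverse z) ≤ 1 := by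
    refine (real_inner_le_norm _ _).trans ?_
    rw [hu, one_mul]
    exact (norm_transverse_le z).trans hz
  have b4 : inner ℝ (cross u (transverse z)) ζ ≤ ‖z‖ ^ 2 := by
    have e : inner ℝ (cross u (transverse z)) ζ = inner ℝ (cross z (transverse z)) ζ := by
      simp only [hzdef, inner_eq, cross_apply_zero, cross_apply_one, cross_apply_two,
        PiLp.sub_apply]
      ring
    have h1 := abs_inner_cross_le z (transverse z) ζ
    have h2 := mul_le_mul_of_nonneg_left (norm_transverse_le z) (norm_nonneg z)
    rw [hζ, mul_one] at h1
    rw [e]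
    nlinarith [le_abs_self (inner ℝ (cross z (transverse z)) ζ)]
  have b5 : ‖cross u ζ‖ ^ 2 = 1 - s ^ 2 := by
    rw [norm_cross_sq, hu, hζ]
    ring
  have hcz : ‖cross u ζ‖ ≤ ‖z‖ := by
    have e : cross u ζ = cross z ζ := by
      refine r3_ext ?_ ?_ ?_ <;> simp [hzdef] <;> ring
    rw [e]
    refine (norm_cross_le _ _).trans ?_
    rw [hζ, mul_one]
  have b6 : inner ℝ (cross u (transverse z)) (cross u ζ) ≤ ‖z‖ ^ 2 := by
    have h1 := real_inner_le_norm (cross u (transverse z)) (cross u ζ)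
    have h2 : ‖cross u (transverse z)‖ ≤ ‖z‖ := by
      refine (norm_cross_le _ _).trans ?_
      rw [hu, one_mul]
      exact norm_transverse_le z
    have h3 := mul_le_mul h2 hcz (norm_nonneg _) (norm_nonneg _)
    nlinarith
  rw [inner_testFieldDeriv, inner_lowerOrder, ← hs, hup, b5]
  have hp0 : 0 ≤ ‖p‖ ^ 2 := by positivity
  have hs2 : 1 / 2 ≤ s := by linarith
  have hαβ : 0 ≤ α * β := mul_nonneg hα hβ
  have hαh : 0 ≤ α * h := mul_nonneg hα hh
  have c1 := mul_le_mul_of_nonneg_left b1 hβ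
  have c2 := mul_le_mul_of_nonneg_left b2 hαβ
  have c3 := mul_le_mul_of_nonneg_left (mul_le_mul_of_nonneg_right b3 hp0) hαβ
  have c4 := mul_le_mul_of_nonneg_left b4 hβ
  have c6 := mul_le_mul_of_nonneg_left b6 hαβ
  have c7 := mul_le_mul_of_nonneg_left (mul_le_mul_of_nonneg_right hs2 hp0) hαh
  have c8 := mul_le_mul_of_nonneg_left (mul_le_mul_of_nonneg_right hs2 hp0) hα
  have c9 : 3 / 4 * ‖z‖ ^ 2 ≤ 1 - s ^ 2 := by rw [hzs]; nlinarith
  have c10 := mul_le_mul_of_nonneg_left c9 hαh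
  linarith

/-- The dissipation estimate: as long as `|u - ζ| ≤ 1`, the flow decreases half the squared
`ℍ¹` distance of `u` from `ζ = H / |H|`, whose formal derivative is the left hand side. -/
lemma dissipation (hab : a < b) (hα : 0 ≤ α) (hβ : 0 ≤ β) {H : R3} (hH : H ≠ 0)
    (hu : HasVecDeriv a b u u')
    (h1 : ∀ᵐ x ∂(intervalMeasure a b), ‖u x‖ = 1) (hw : MemLp w 2 (intervalMeasure a b))
    (hN : IsNeumannLaplacian a b u' w)
    (hz : ∀ᵐ x ∂(intervalMeasure a b), ‖u x - ‖H‖⁻¹ • H‖ ≤ 1) :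
    -(∫ x in Ioo a b, inner ℝ (w x) (rhsField α β (appliedField β H) (u x) (w x))) -
      ∫ x in Ioo a b, inner ℝ (rhsField α β (appliedField β H) (u x) (w x)) (‖H‖⁻¹ • H) ≤
    (β + 2 * α * β - α * ‖H‖ / 2 - α / 2) * (∫ x in Ioo a b, ‖u' x‖ ^ 2) +
      (β + α * β - 3 / 4 * (α * ‖H‖)) * ∫ x in Ioo a b, ‖u x - ‖H‖⁻¹ • H‖ ^ 2 := by
  have hH0 : 0 < ‖H‖ := norm_pos_iff.2 hH
  set ζ := ‖H‖⁻¹ • H with hζdef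
  have hζ : ‖ζ‖ = 1 := by
    rw [hζdef, norm_smul, norm_inv, norm_norm, inv_mul_cancel₀ hH0.ne']
  have hHζ : H = ‖H‖ • ζ := by
    rw [hζdef, smul_smul, mul_inv_cancel₀ hH0.ne', one_smul]
  set K := appliedField β H with hK
  have hlow : ∀ x, lowerField β K (u x) = ‖H‖ • ζ - β • transverse (u x - ζ) := fun x => by
    rw [hK, lowerField_appliedField, ← hζdef, ← hHζ]
  have hl : HasVecDeriv a b (fun x => lowerField β K (u x))
      (fun x => -(β • transverse (u' x))) := by
    refine ((HasVecDeriv.const (‖H‖ • ζ)).sub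
      (HasVecDeriv.const_smul β (hu.sub (HasVecDeriv.const ζ)).transverse)).congr ?_ ?_
    · exact ae_of_all _ hlow
    · exact ae_of_all _ fun x => by simp
  have hψ := hu.testField hab.le hl α ζ
  have key := hN _ _ hψ
  have hum := (hu.memLp hab.le 2).1
  have hle : ∀ᵐ x ∂(intervalMeasure a b), ‖u x‖ ≤ 1 := by
    filter_upwards [h1] with x hx using hx.le
  have hF := memLp_rhsField hα hβ K hum h1 hw
  have hζm : MemLp (fun _ : ℝ => ζ) 2 (intervalMeasure a b) := memLp_const _
  have hl2 := hl.memLp hab.le 2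
  have m2 := memLp_cross_of_bdd hum hle hl2
  have m3 : MemLp (fun x => cross (u x) (lowerField β K (u x)) -
      α • cross (u x) (cross (u x) (lowerField β K (u x)))) 2 (intervalMeasure a b) :=
    m2.sub ((memLp_cross_of_bdd hum hle m2).const_smul α)
  have i1 := integrable_inner_of_memLp hw hF
  have i2 := integrable_inner_of_memLp hF hζm
  have i3 := integrable_inner_of_memLp hw (hψ.memLp hab.le 2)
  have i4 := integrable_norm_sq (memLp_cross_of_bdd hum hle hw)
  have i5 := integrable_inner_of_memLp m3 hζm
  have i6 := integrable_inner_of_memLp hψ.memLp_deriv hu.memLp_deriv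
  have i7 := integrable_norm_sq hu.memLp_deriv
  have m8 : MemLp (fun x => u x - ζ) 2 (intervalMeasure a b) := (hu.memLp hab.le 2).sub hζm
  have i8 := integrable_norm_sq m8
  have s1 : -(∫ x in Ioo a b, inner ℝ (w x) (rhsField α β K (u x) (w x))) -
      (∫ x in Ioo a b, inner ℝ (rhsField α β K (u x) (w x)) ζ) =
      (-(∫ x in Ioo a b, inner ℝ (w x) (testField α ζ (u x) (lowerField β K (u x))))
      - α * ∫ x in Ioo a b, ‖cross (u x) (w x)‖ ^ 2) -
      ∫ x in Ioo a b, inner ℝ (cross (u x) (lowerField β K (u x)) -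
        α • cross (u x) (cross (u x) (lowerField β K (u x)))) ζ := by
    have e := integral_congr_ae (μ := intervalMeasure a b)
      (ae_of_all _ fun x => inner_rhsField_testField (α := α) (β := β) K (u x) (w x) ζ)
    have i34 : Integrable (fun x => -inner ℝ (w x) (testField α ζ (u x) (lowerField β K (u x))) -
        α * ‖cross (u x) (w x)‖ ^ 2) (intervalMeasure a b) := i3.fun_neg.sub (i4.const_mul α)
    rw [integral_sub i1.fun_neg i2, integral_sub i34 i5,
      integral_sub i3.fun_neg (i4.const_mul α), integral_neg, integral_neg, integral_const_mul] at e
    exact e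
  have s2 : ∫ x in Ioo a b, inner ℝ (w x) (testField α ζ (u x) (lowerField β K (u x))) =
      ∫ x in Ioo a b, inner ℝ (testField α ζ (u x) (lowerField β K (u x))) (w x) := by
    refine integral_congr_ae (ae_of_all _ fun x => real_inner_comm _ _)
  have s3 : 0 ≤ ∫ x in Ioo a b, ‖cross (u x) (w x)‖ ^ 2 :=
    integral_nonneg fun _ => by positivity
  rw [s1, s2, ← key]
  have s4 := mul_nonneg hα s3
  have s5 : (∫ x in Ioo a b, inner ℝ (testFieldDeriv α ζ (u x) (lowerField β K (u x)) (u' x)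
        (-(β • transverse (u' x)))) (u' x)) -
      (∫ x in Ioo a b, inner ℝ (cross (u x) (lowerField β K (u x)) -
        α • cross (u x) (cross (u x) (lowerField β K (u x)))) ζ) ≤
      (β + 2 * α * β - α * ‖H‖ / 2 - α / 2) * (∫ x in Ioo a b, ‖u' x‖ ^ 2) +
      (β + α * β - 3 / 4 * (α * ‖H‖)) * ∫ x in Ioo a b, ‖u x - ζ‖ ^ 2 := by
    rw [← integral_const_mul, ← integral_const_mul,
      ← integral_add (i7.const_mul _) (i8.const_mul _)]
    rw [← integral_sub i6 i5]
    refine integral_mono_ae (i6.sub i5) ((i7.const_mul _).add (i8.const_mul _)) ?_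
    filter_upwards [h1, hu.inner_deriv_eq_zero hab h1, hz] with x x1 x2 x3
    have := dissipation_pointwise hα hβ (norm_nonneg H) x1 x2 hζ x3
    rw [← hlow x] at this
    exact this
  linarith

end

section

variable {a b : ℝ} {f h : ℝ → ℝ}

/-! ### Cosine and sine expansions -/

/-- The affine map of `[a, b]` onto `[0, π]`. -/
def angle (a b x : ℝ) : ℝ := Real.pi / (b - a) * (x - a)

/-- The eigenfunctions of the Neumann Laplacian on `(a, b)`. -/
def cosMode (a b : ℝ) (n : ℕ) (x : ℝ) : ℝ := Real.cos (n * angle a b x)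

/-- The eigenfunctions of the Dirichlet Laplacian on `(a, b)`. -/
def sinMode (a b : ℝ) (n : ℕ) (x : ℝ) : ℝ := Real.sin (n * angle a b x)

lemma continuous_angle : Continuous (angle a b) := by unfold angle; fun_prop
lemma continuous_cosMode (n : ℕ) : Continuous (cosMode a b n) := by
  unfold cosMode angle; fun_prop
lemma continuous_sinMode (n : ℕ) : Continuous (sinMode a b n) := by
  unfold sinMode angle; fun_prop

lemma integrable_mul_continuous (hf : Integrable f (intervalMeasure a b)) (hh : Continuous h) :
    Integrable (fun x => f x * h x) (intervalMeasure a b) := by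
  obtain ⟨C, hC⟩ := isCompact_Icc.exists_bound_of_continuousOn (hh.continuousOn (s := Icc a b))
  refine hf.mul_bdd (c := C) hh.aestronglyMeasurable ?_
  filter_upwards [ae_restrict_mem measurableSet_Ioo] with x hx using hC x (Ioo_subset_Icc_self hx)

lemma integral_cos_angle (hab : a < b) {k : ℤ} (hk : k ≠ 0) :
    ∫ x in Ioo a b, Real.cos (k * angle a b x) = 0 := by
  have hl : b - a ≠ 0 := (sub_pos.2 hab).ne'
  have hk' : (k : ℝ) ≠ 0 := Int.cast_ne_zero.2 hk
  have hc : (k : ℝ) * (Real.pi / (b - a)) ≠ 0 := mul_ne_zero hk' (div_ne_zero Real.pi_ne_zero hl)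
  have hd : ∀ x ∈ uIcc a b, HasDerivAt
      (fun x => (k * (Real.pi / (b - a)))⁻¹ * Real.sin (k * angle a b x))
      (Real.cos (k * angle a b x)) x := by
    intro x _
    have h1 : HasDerivAt (fun x => k * angle a b x) (k * (Real.pi / (b - a))) x := by
      have := (((hasDerivAt_id x).sub_const a).const_mul (Real.pi / (b - a))).const_mul (k : ℝ)
      simpa [angle] using this
    convert! (h1.sin.const_mul (k * (Real.pi / (b - a)))⁻¹) using 1
    field_simp
  rw [integral_Ioo_eq_interval hab.le, intervalIntegral.integral_eq_sub_of_hasDerivAt hd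
    (Continuous.intervalIntegrable (by unfold angle; fun_prop) _ _)]
  have e1 : angle a b b = Real.pi := by simp [angle, div_mul_cancel₀ _ hl]
  have e2 : angle a b a = 0 := by simp [angle]
  rw [e1, e2, Real.sin_int_mul_pi]
  simp

/-- The cosines `cos (n π (x - a) / (b - a))`, `n ≥ 0`, are complete: by Weierstrass' theorem the
polynomials in the first of them are dense in the continuous functions. -/
lemma ae_eq_zero_of_integral_cosMode (hab : a < b) (hf : Integrable f (intervalMeasure a b))
    (h0 : ∀ n, ∫ x in Ioo a b, f x * cosMode a b n x = 0) :
    ∀ᵐ x ∂(intervalMeasure a b), f x = 0 := by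
  have hl : 0 < b - a := sub_pos.2 hab
  have hpow : ∀ k n : ℕ,
      ∫ x in Ioo a b, f x * (Real.cos (angle a b x) ^ k * cosMode a b n x) = 0 := by
    intro k
    induction k with
    | zero => intro n; simpa using h0 n
    | succ k ih =>
      intro n
      have hi : ∀ m, Integrable (fun x => f x * (Real.cos (angle a b x) ^ k * cosMode a b m x))
          (intervalMeasure a b) := fun m => integrable_mul_continuous hf
        (((Real.continuous_cos.comp continuous_angle).pow k).mul (continuous_cosMode m))
      rcases n with _ | n
      · refine Eq.trans (integral_congr_ae (ae_of_all _ fun x => ?_)) (ih 1)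
        simp [cosMode]
        ring_nf
        simp
      · have e : ∀ x, f x * (Real.cos (angle a b x) ^ (k + 1) * cosMode a b (n + 1) x) =
            1 / 2 * (f x * (Real.cos (angle a b x) ^ k * cosMode a b (n + 2) x)) +
            1 / 2 * (f x * (Real.cos (angle a b x) ^ k * cosMode a b n x)) := by
          intro x
          have : cosMode a b (n + 2) x + cosMode a b n x =
              2 * Real.cos (angle a b x) * cosMode a b (n + 1) x := by
            simp only [cosMode]
            rw [Real.cos_add_cos]
            push_cast
            ring_nf
          rw [← mul_add, ← mul_add, ← mul_add, this]
          ring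
        simp_rw [e]
        rw [integral_add ((hi _).const_mul _) ((hi _).const_mul _), integral_const_mul,
          integral_const_mul, ih, ih]
        simp
  have hpoly : ∀ p : Polynomial ℝ, ∫ x in Ioo a b, f x * p.eval (Real.cos (angle a b x)) = 0 := by
    intro p
    induction p using Polynomial.induction_on' with
    | add p q hp hq =>
      have hi : ∀ p : Polynomial ℝ, Integrable (fun x => f x * p.eval (Real.cos (angle a b x)))
          (intervalMeasure a b) := fun p => integrable_mul_continuous hf
        (p.continuous.comp (Real.continuous_cos.comp continuous_angle))
      simp_rw [Polynomial.eval_add, mul_add]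
      rw [integral_add (hi p) (hi q), hp, hq, add_zero]
    | monomial n c =>
      have e : ∀ x, f x * (Polynomial.monomial n c).eval (Real.cos (angle a b x)) =
          c * (f x * (Real.cos (angle a b x) ^ n * cosMode a b 0 x)) := by
        intro x
        simp [cosMode]
        ring
      simp_rw [e]
      rw [integral_const_mul, hpow, mul_zero]
  have hcont : ∀ φ : ℝ → ℝ, Continuous φ → ∫ x in Ioo a b, f x * φ x = 0 := by
    intro φ hφ
    -- a continuous function of `x` is a continuous function of `cos (angle a b x)`
    set q : ℝ → ℝ := fun t => φ (a + (b - a) / Real.pi * Real.arccos t) with hq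
    have hqc : Continuous q := hφ.comp
      (continuous_const.add (continuous_const.mul Real.continuous_arccos))
    have hqφ : ∀ x ∈ Ioo a b, q (Real.cos (angle a b x)) = φ x := by
      intro x hx
      have h1 : 0 ≤ angle a b x :=
        mul_nonneg (div_nonneg Real.pi_pos.le hl.le) (sub_nonneg.2 hx.1.le)
      have h2 : angle a b x ≤ Real.pi := by
        rw [angle, div_mul_eq_mul_div, div_le_iff₀ hl]
        exact mul_le_mul_of_nonneg_left (by linarith [hx.2]) Real.pi_pos.le
      rw [hq]
      simp only
      rw [Real.arccos_cos h1 h2, angle]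
      congr 1
      have := Real.pi_ne_zero
      field_simp
      ring
    by_contra hne
    set I := ∫ x in Ioo a b, f x * φ x with hI
    have hIpos : 0 < |I| := abs_pos.2 hne
    set S := ∫ x in Ioo a b, |f x| with hS
    have hS0 : 0 ≤ S := integral_nonneg fun _ => abs_nonneg _
    obtain ⟨p, hp⟩ := exists_polynomial_near_of_continuousOn (-1) 1 q hqc.continuousOn
      (|I| / (S + 1)) (by positivity)
    have h1 : I = ∫ x in Ioo a b, f x * (φ x - p.eval (Real.cos (angle a b x))) := by
      have hpi : Integrable (fun x => f x * p.eval (Real.cos (angle a b x)))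
          (intervalMeasure a b) := integrable_mul_continuous hf
          (p.continuous.comp (Real.continuous_cos.comp continuous_angle))
      simp_rw [mul_sub]
      rw [integral_sub (integrable_mul_continuous hf hφ) hpi, hpoly, sub_zero]
    have h2 : |I| ≤ |I| / (S + 1) * S := by
      nth_rewrite 1 [h1]
      rw [← Real.norm_eq_abs, hS, ← integral_const_mul]
      refine norm_integral_le_of_norm_le (hf.abs.const_mul _) ?_
      filter_upwards [ae_restrict_mem measurableSet_Ioo] with x hx
      rw [norm_mul, mul_comm, ← hqφ x hx, Real.norm_eq_abs, Real.norm_eq_abs, abs_sub_comm]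
      exact mul_le_mul_of_nonneg_right
        (hp _ ⟨Real.neg_one_le_cos _, Real.cos_le_one _⟩).le (abs_nonneg _)
    rw [div_mul_eq_mul_div, le_div_iff₀ (by positivity)] at h2
    linarith
  have := isOpen_Ioo.ae_eq_zero_of_integral_contDiff_smul_eq_zero (U := Ioo a b) (μ := volume)
    (f := f) (IntegrableOn.locallyIntegrableOn hf) (fun φ hφ hφc hφt => by
      rw [← hcont φ hφ.continuous]
      rw [setIntegral_eq_integral_of_forall_compl_eq_zero]
      · simp [mul_comm]
      · intro x hx
        have : φ x = 0 := image_eq_zero_of_notMem_tsupport fun hh => hx (hφt hh)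
        simp [this])
  rw [ae_restrict_iff' measurableSet_Ioo]
  exact this

/-- The sines are complete, too: if `f` is orthogonal to all of them, then `f` times the first one
is orthogonal to all cosines. -/
lemma ae_eq_zero_of_integral_sinMode (hab : a < b) (hf : Integrable f (intervalMeasure a b))
    (h0 : ∀ n, ∫ x in Ioo a b, f x * sinMode a b (n + 1) x = 0) :
    ∀ᵐ x ∂(intervalMeasure a b), f x = 0 := by
  have hl : 0 < b - a := sub_pos.2 hab
  have h0' : ∀ n, ∫ x in Ioo a b, f x * sinMode a b n x = 0 := by
    rintro (_ | n)
    · simp [sinMode]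
    · exact h0 n
  have hi : ∀ n, Integrable (fun x => f x * sinMode a b n x) (intervalMeasure a b) := fun n =>
    integrable_mul_continuous hf (continuous_sinMode n)
  have key : ∀ᵐ x ∂(intervalMeasure a b), f x * sinMode a b 1 x = 0 := by
    refine ae_eq_zero_of_integral_cosMode hab (hi 1) fun n => ?_
    rcases n with _ | n
    · simpa [cosMode] using h0' 1
    · have e : ∀ x, f x * sinMode a b 1 x * cosMode a b (n + 1) x =
          1 / 2 * (f x * sinMode a b (n + 2) x) - 1 / 2 * (f x * sinMode a b n x) := by
        intro x
        have : sinMode a b (n + 2) x - sinMode a b n x =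
            2 * sinMode a b 1 x * cosMode a b (n + 1) x := by
          simp only [sinMode, cosMode]
          rw [Real.sin_sub_sin]
          push_cast
          ring_nf
        rw [← mul_sub, ← mul_sub, this]
        ring
      simp_rw [e]
      rw [integral_sub ((hi _).const_mul _) ((hi _).const_mul _), integral_const_mul,
        integral_const_mul, h0', h0']
      simp
  filter_upwards [key, ae_restrict_mem measurableSet_Ioo] with x hx hm
  have h1 : 0 < angle a b x := mul_pos (div_pos Real.pi_pos hl) (sub_pos.2 hm.1)
  have h2 : angle a b x < Real.pi := by
    rw [angle, div_mul_eq_mul_div, div_lt_iff₀ hl]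
    exact mul_lt_mul_of_pos_left (by linarith [hm.2]) Real.pi_pos
  have h3 : sinMode a b 1 x ≠ 0 := by
    simpa [sinMode] using (Real.sin_pos_of_pos_of_lt_pi h1 h2).ne'
  exact (mul_eq_zero.1 hx).resolve_right h3

/-- Parseval's identity for a complete orthonormal sequence of continuous functions. -/
lemma hasSum_integral_mul_integral {e : ℕ → ℝ → ℝ} (he : ∀ n, Continuous (e n))
    (horth : ∀ m n, ∫ x in Ioo a b, e m x * e n x = if m = n then 1 else 0)
    (hcomp : ∀ f : ℝ → ℝ, Integrable f (intervalMeasure a b) →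
      (∀ n, ∫ x in Ioo a b, f x * e n x = 0) → ∀ᵐ x ∂(intervalMeasure a b), f x = 0)
    (hf : MemLp f 2 (intervalMeasure a b)) (hh : MemLp h 2 (intervalMeasure a b)) :
    HasSum (fun n => (∫ x in Ioo a b, f x * e n x) * ∫ x in Ioo a b, h x * e n x)
      (∫ x in Ioo a b, f x * h x) := by
  have hem : ∀ n, MemLp (e n) 2 (intervalMeasure a b) := fun n =>
    memLp_of_continuousOn (he n).continuousOn 2
  have hin : ∀ {p q : ℝ → ℝ} (hp : MemLp p 2 (intervalMeasure a b))
      (hq : MemLp q 2 (intervalMeasure a b)),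
      inner ℝ (hp.toLp p) (hq.toLp q) = ∫ x in Ioo a b, p x * q x := by
    intro p q hp hq
    rw [L2.inner_def]
    refine integral_congr_ae ?_
    filter_upwards [hp.coeFn_toLp, hq.coeFn_toLp] with x h1 h2
    rw [h1, h2]
    simp [mul_comm]
  have hon : Orthonormal ℝ fun n => (hem n).toLp (e n) := by
    rw [orthonormal_iff_ite]
    intro m n
    rw [hin, horth]
  have hbot : (Submodule.span ℝ (Set.range fun n => (hem n).toLp (e n)))ᗮ = ⊥ := by
    rw [Submodule.eq_bot_iff]
    intro p hp
    rw [Submodule.mem_orthogonal] at hp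
    have hp2 := Lp.memLp p
    have := hcomp p (hp2.integrable (by norm_num)) (fun n => by
      have h1 := hp _ (Submodule.subset_span ⟨n, rfl⟩)
      rw [← Lp.toLp_coeFn p hp2] at h1
      simp only at h1
      rw [hin] at h1
      simpa [mul_comm] using h1)
    rw [Lp.eq_zero_iff_ae_eq_zero]
    exact this
  have key := (HilbertBasis.mkOfOrthogonalEqBot hon hbot).hasSum_inner_mul_inner
    (hf.toLp f) (hh.toLp h)
  rw [hin] at key
  simp only [HilbertBasis.coe_mkOfOrthogonalEqBot] at key
  simp_rw [hin] at key
  simpa [mul_comm (e _ _)] using key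

lemma integral_cosMode_mul (hab : a < b) (m n : ℕ) :
    ∫ x in Ioo a b, cosMode a b m x * cosMode a b n x =
      if m = n then (if n = 0 then b - a else (b - a) / 2) else 0 := by
  have hi : ∀ k : ℤ, Integrable (fun x => 1 / 2 * Real.cos (k * angle a b x))
      (intervalMeasure a b) := fun k => (memLp_of_continuousOn (p := 1)
        (Continuous.continuousOn (by unfold angle; fun_prop))).integrable le_rfl
  have e : ∀ x, cosMode a b m x * cosMode a b n x =
      1 / 2 * Real.cos (((m : ℤ) - n : ℤ) * angle a b x) +
        1 / 2 * Real.cos (((m : ℤ) + n : ℤ) * angle a b x) := by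
    intro x
    simp only [cosMode]
    push_cast
    rw [sub_mul, add_mul, Real.cos_sub, Real.cos_add]
    ring
  simp_rw [e]
  rw [integral_add (hi _) (hi _), integral_const_mul, integral_const_mul]
  split_ifs with h1 h2
  · subst h1; subst h2
    simp [Real.volume_real_Ioo_of_le hab.le]
    ring
  · subst h1
    rw [integral_cos_angle hab (k := (m : ℤ) + m) (by omega)]
    simp [Real.volume_real_Ioo_of_le hab.le]
    ring
  · rw [integral_cos_angle hab (by omega), integral_cos_angle hab (by omega)]
    simp

lemma integral_sinMode_mul (hab : a < b) (m n : ℕ) :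
    ∫ x in Ioo a b, sinMode a b (m + 1) x * sinMode a b (n + 1) x =
      if m = n then (b - a) / 2 else 0 := by
  have hi : ∀ k : ℤ, Integrable (fun x => 1 / 2 * Real.cos (k * angle a b x))
      (intervalMeasure a b) := fun k => (memLp_of_continuousOn (p := 1)
        (Continuous.continuousOn (by unfold angle; fun_prop))).integrable le_rfl
  have e : ∀ x, sinMode a b (m + 1) x * sinMode a b (n + 1) x =
      1 / 2 * Real.cos (((m : ℤ) - n : ℤ) * angle a b x) -
        1 / 2 * Real.cos (((m : ℤ) + n + 2 : ℤ) * angle a b x) := by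
    intro x
    simp only [sinMode]
    push_cast
    have e1 : ((m : ℝ) - n) * angle a b x = (m + 1) * angle a b x - (n + 1) * angle a b x := by ring
    have e2 : ((m : ℝ) + n + 2) * angle a b x = (m + 1) * angle a b x + (n + 1) * angle a b x := by
      ring
    rw [e1, e2, Real.cos_sub, Real.cos_add]
    ring
  simp_rw [e]
  rw [integral_sub (hi _) (hi _), integral_const_mul, integral_const_mul,
    integral_cos_angle hab (k := (m : ℤ) + n + 2) (by omega)]
  split_ifs with h1
  · subst h1
    simp [Real.volume_real_Ioo_of_le hab.le]
    ring
  · rw [integral_cos_angle hab (by omega)]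
    simp

/-- The reciprocal of `∫ cosMode²`. -/
def cosWeight (a b : ℝ) (n : ℕ) : ℝ := if n = 0 then 1 / (b - a) else 2 / (b - a)

lemma cosWeight_nonneg (hab : a < b) (n : ℕ) : 0 ≤ cosWeight a b n := by
  have hl : 0 < b - a := sub_pos.2 hab
  unfold cosWeight
  split_ifs <;> positivity

/-- Parseval's identity for the cosine expansion. -/
lemma hasSum_cosMode (hab : a < b) (hf : MemLp f 2 (intervalMeasure a b))
    (hh : MemLp h 2 (intervalMeasure a b)) :
    HasSum (fun n => cosWeight a b n * ((∫ x in Ioo a b, f x * cosMode a b n x) *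
      ∫ x in Ioo a b, h x * cosMode a b n x)) (∫ x in Ioo a b, f x * h x) := by
  have hl : 0 < b - a := sub_pos.2 hab
  set c : ℕ → ℝ := fun n => √(cosWeight a b n) with hc
  have hcc : ∀ n, c n * c n = cosWeight a b n := fun n =>
    Real.mul_self_sqrt (cosWeight_nonneg hab n)
  have hcsq : ∀ n, c n * c n * (if n = 0 then b - a else (b - a) / 2) = 1 := by
    intro n
    rw [hcc, cosWeight]
    split_ifs <;> field_simp
  have hc0 : ∀ n, c n ≠ 0 := by
    intro n h
    simpa [h] using hcsq n
  have hmul : ∀ (p : ℝ → ℝ) n, ∫ x in Ioo a b, p x * (c n * cosMode a b n x) =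
      c n * ∫ x in Ioo a b, p x * cosMode a b n x := by
    intro p n
    rw [← integral_const_mul]
    congr 1
    ext x
    ring
  have key := hasSum_integral_mul_integral (a := a) (b := b)
    (e := fun n x => c n * cosMode a b n x)
    (fun n => continuous_const.mul (continuous_cosMode n)) (fun m n => by
      rw [hmul]
      simp_rw [mul_assoc (c m)]
      rw [integral_const_mul, integral_cosMode_mul hab]
      by_cases h1 : m = n
      · rw [if_pos h1, if_pos h1, ← hcsq n, h1]
        ring
      · simp [h1]) (fun p hp hp0 => ae_eq_zero_of_integral_cosMode hab hp fun n => by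
        have := hp0 n
        rw [hmul] at this
        exact (mul_eq_zero.1 this).resolve_left (hc0 n)) hf hh
  refine key.congr_fun fun n => ?_
  rw [hmul, hmul, ← hcc]
  ring

/-- Parseval's identity for the sine expansion. -/
lemma hasSum_sinMode (hab : a < b) (hf : MemLp f 2 (intervalMeasure a b))
    (hh : MemLp h 2 (intervalMeasure a b)) :
    HasSum (fun n => 2 / (b - a) * ((∫ x in Ioo a b, f x * sinMode a b n x) *
      ∫ x in Ioo a b, h x * sinMode a b n x)) (∫ x in Ioo a b, f x * h x) := by
  have hl : 0 < b - a := sub_pos.2 hab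
  set c : ℝ := √(2 / (b - a)) with hc
  have hc0 : c ≠ 0 := by positivity
  have hcsq : c * c = 2 / (b - a) := Real.mul_self_sqrt (by positivity)
  have hmul : ∀ (p : ℝ → ℝ) n, ∫ x in Ioo a b, p x * (c * sinMode a b n x) =
      c * ∫ x in Ioo a b, p x * sinMode a b n x := by
    intro p n
    rw [← integral_const_mul]
    congr 1
    ext x
    ring
  have key := hasSum_integral_mul_integral (a := a) (b := b)
    (e := fun n x => c * sinMode a b (n + 1) x)
    (fun n => continuous_const.mul (continuous_sinMode (n + 1))) (fun m n => by
      rw [hmul]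
      simp_rw [mul_assoc c]
      rw [integral_const_mul, integral_sinMode_mul hab]
      split_ifs with h1
      · rw [← mul_assoc, hcsq]; field_simp
      · simp) (fun p hp hp0 => ae_eq_zero_of_integral_sinMode hab hp fun n => by
        have := hp0 n
        rw [hmul] at this
        exact (mul_eq_zero.1 this).resolve_left hc0) hf hh
  rw [← hasSum_nat_add_iff' 1]
  simp only [Finset.range_one, Finset.sum_singleton]
  have z : ∫ x in Ioo a b, f x * sinMode a b 0 x = 0 := by simp [sinMode]
  rw [z, zero_mul, mul_zero, sub_zero]
  refine key.congr_fun fun n => ?_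
  rw [hmul, hmul, ← hcsq]
  ring

end

section

variable {a b : ℝ}

/-! ### The energy identity -/

/-- The vector valued cosine modes. -/
def vecMode (a b : ℝ) (n : ℕ) (i : Fin 3) (x : ℝ) : R3 :=
  cosMode a b n x • EuclideanSpace.single i (1 : ℝ)

/-- The eigenvalues of the negative Neumann Laplacian on `(a, b)`. -/
def eigenvalue (a b : ℝ) (n : ℕ) : ℝ := (n * (Real.pi / (b - a))) ^ 2

lemma inner_vecMode (v : R3) (n : ℕ) (i : Fin 3) (x : ℝ) :
    inner ℝ v (vecMode a b n i x) = v i * cosMode a b n x := by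
  rw [vecMode, real_inner_smul_right, EuclideanSpace.inner_single_right]
  simp [mul_comm]

lemma hasDerivAt_mul_angle (n : ℕ) (x : ℝ) :
    HasDerivAt (fun x => n * angle a b x) (n * (Real.pi / (b - a))) x := by
  have := (((hasDerivAt_id x).sub_const a).const_mul (Real.pi / (b - a))).const_mul (n : ℝ)
  simpa [angle] using this

lemma deriv_cosMode (n : ℕ) :
    deriv (cosMode a b n) = fun x => -(n * (Real.pi / (b - a)) * sinMode a b n x) := by
  ext x
  rw [show cosMode a b n = fun x => Real.cos (n * angle a b x) from rfl,
    (hasDerivAt_mul_angle n x).cos.deriv, sinMode]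
  ring

lemma deriv_sinMode (n : ℕ) :
    deriv (sinMode a b n) = fun x => n * (Real.pi / (b - a)) * cosMode a b n x := by
  ext x
  rw [show sinMode a b n = fun x => Real.sin (n * angle a b x) from rfl,
    (hasDerivAt_mul_angle n x).sin.deriv, cosMode]
  ring

lemma contDiff_cosMode (n : ℕ) : ContDiff ℝ 1 (cosMode a b n) := by
  unfold cosMode angle; fun_prop

lemma contDiff_sinMode (n : ℕ) : ContDiff ℝ 1 (sinMode a b n) := by
  unfold sinMode angle; fun_prop

lemma continuous_vecMode (n : ℕ) (i : Fin 3) : Continuous (vecMode a b n i) :=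
  (continuous_cosMode n).smul continuous_const

lemma hasVecDeriv_vecMode (hab : a ≤ b) (n : ℕ) (i : Fin 3) :
    HasVecDeriv a b (vecMode a b n i)
      fun x => -(n * (Real.pi / (b - a)) * sinMode a b n x) • EuclideanSpace.single i (1 : ℝ) := by
  have h := HasH1Deriv.of_contDiff (a := a) (b := b) (contDiff_cosMode (a := a) (b := b) n)
  rw [deriv_cosMode] at h
  refine (HasVecDeriv.smul hab h (HasVecDeriv.const (EuclideanSpace.single i (1 : ℝ)))).congr
    ae_eq_rfl ?_
  exact ae_of_all _ fun x => by simp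

lemma sinMode_left (n : ℕ) : sinMode a b n a = 0 := by simp [sinMode, angle]

lemma sinMode_right (hab : a < b) (n : ℕ) : sinMode a b n b = 0 := by
  have hl : b - a ≠ 0 := (sub_pos.2 hab).ne'
  simp [sinMode, angle, div_mul_cancel₀ _ hl, Real.sin_nat_mul_pi]

variable {u u' w : ℝ → R3}

/-- The sine coefficients of the derivative, in terms of the cosine coefficients. -/
lemma HasVecDeriv.integral_sinMode (hab : a < b) (hu : HasVecDeriv a b u u') (n : ℕ) (i : Fin 3) :
    ∫ x in Ioo a b, u' x i * sinMode a b n x =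
      -(n * (Real.pi / (b - a)) * ∫ x in Ioo a b, Inner.inner ℝ (u x) (vecMode a b n i x)) := by
  have h := (hu i).integral_mul_deriv hab (contDiff_sinMode n) (sinMode_left n)
    (sinMode_right hab n)
  simp_rw [inner_vecMode]
  rw [deriv_sinMode] at h
  have e : ∀ x, u x i * (n * (Real.pi / (b - a)) * cosMode a b n x) =
      n * (Real.pi / (b - a)) * (u x i * cosMode a b n x) := fun x => by ring
  simp_rw [e] at h
  rw [integral_const_mul] at h
  linarith

/-- The cosine coefficients of the Neumann Laplacian. -/
lemma IsNeumannLaplacian.integral_vecMode (hab : a < b) (hu : HasVecDeriv a b u u')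
    (hN : IsNeumannLaplacian a b u' w) (n : ℕ) (i : Fin 3) :
    ∫ x in Ioo a b, w x i * cosMode a b n x =
      -(eigenvalue a b n * ∫ x in Ioo a b, inner ℝ (u x) (vecMode a b n i x)) := by
  have h1 := hN _ _ (hasVecDeriv_vecMode hab.le n i)
  have h2 := hu.integral_sinMode hab n i
  have e1 : ∀ x, inner ℝ (vecMode a b n i x) (w x) = w x i * cosMode a b n x := fun x => by
    rw [real_inner_comm, inner_vecMode]
  have e2 : ∀ x, inner ℝ (-(n * (Real.pi / (b - a)) * sinMode a b n x) •
      EuclideanSpace.single i (1 : ℝ)) (u' x) =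
      -(n * (Real.pi / (b - a))) * (u' x i * sinMode a b n x) := fun x => by
    rw [real_inner_smul_left, EuclideanSpace.inner_single_left]
    simp
    ring
  simp_rw [e1, e2] at h1
  rw [integral_const_mul, h2] at h1
  rw [eigenvalue]
  linarith

lemma integral_inner_eq_sum {v : ℝ → R3} (hu : MemLp u 2 (intervalMeasure a b))
    (hv : MemLp v 2 (intervalMeasure a b)) :
    ∫ x in Ioo a b, inner ℝ (u x) (v x) = ∑ i, ∫ x in Ioo a b, u x i * v x i := by
  rw [← integral_finsetSum]
  · refine integral_congr_ae (ae_of_all _ fun x => ?_)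
    simp only [inner_eq, Fin.sum_univ_three]
  · intro i _
    exact (memLp_vec_iff.1 hu i).integrable_mul (memLp_vec_iff.1 hv i)

/-- The Dirichlet integral, in terms of the cosine coefficients. -/
lemma HasVecDeriv.hasSum_dirichlet (hab : a < b) (hu : HasVecDeriv a b u u') :
    HasSum (fun n => ∑ i, 2 / (b - a) * eigenvalue a b n *
      (∫ x in Ioo a b, Inner.inner ℝ (u x) (vecMode a b n i x)) ^ 2)
      (∫ x in Ioo a b, ‖u' x‖ ^ 2) := by
  have h2 := hu.memLp_deriv
  simp_rw [← real_inner_self_eq_norm_sq]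
  rw [integral_inner_eq_sum h2 h2]
  refine hasSum_sum fun i _ => ?_
  refine (hasSum_sinMode hab (memLp_vec_iff.1 h2 i) (memLp_vec_iff.1 h2 i)).congr_fun fun n => ?_
  rw [hu.integral_sinMode hab, eigenvalue]
  ring

/-- Parseval's identity for vector functions. -/
lemma hasSum_vecCosMode (hab : a < b) {v : ℝ → R3} (hu : MemLp u 2 (intervalMeasure a b))
    (hv : MemLp v 2 (intervalMeasure a b)) :
    HasSum (fun n => ∑ i, cosWeight a b n * ((∫ x in Ioo a b, u x i * cosMode a b n x) *
      ∫ x in Ioo a b, v x i * cosMode a b n x)) (∫ x in Ioo a b, inner ℝ (u x) (v x)) := by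
  rw [integral_inner_eq_sum hu hv]
  exact hasSum_sum fun i _ => hasSum_cosMode hab (memLp_vec_iff.1 hu i) (memLp_vec_iff.1 hv i)

/-- The exceptional weight of the constant mode does not matter, as its eigenvalue is zero. -/
lemma eigenvalue_mul_cosWeight (n : ℕ) :
    eigenvalue a b n * cosWeight a b n = 2 / (b - a) * eigenvalue a b n := by
  rcases n with _ | n
  · simp [eigenvalue]
  · simp [cosWeight, mul_comm]

/-- The square of an absolutely continuous function of time. -/
lemma sq_eq_add_integral {c r : ℝ → ℝ} {t : ℝ} (ht : 0 ≤ t) (hr : IntervalIntegrable r volume 0 t)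
    (hc : ∀ s ∈ Icc 0 t, c s = c 0 + ∫ q in (0 : ℝ)..s, r q) :
    IntervalIntegrable (fun s => c s * r s) volume 0 t ∧
    c t ^ 2 = c 0 ^ 2 + ∫ s in (0 : ℝ)..t, 2 * (c s * r s) := by
  set C : ℝ → ℝ := fun s => c 0 + ∫ q in (0 : ℝ)..s, r q with hC
  have hac : AbsolutelyContinuousOnInterval C 0 t :=
    ((contDiff_const (c := c 0) (n := 1)).contDiffOn.absolutelyContinuousOnInterval).fun_add
      (hr.absolutelyContinuousOnInterval_intervalIntegral left_mem_uIcc)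
  have hcC : EqOn c C (uIcc 0 t) := fun s hs => hc s (by rwa [uIcc_of_le ht] at hs)
  have hint : IntervalIntegrable (fun s => c s * r s) volume 0 t := by
    refine (hr.continuousOn_mul hac.continuousOn).congr_uIoo ?_
    intro s hs
    simp only
    rw [hcC (Ioo_subset_Icc_self hs)]
  refine ⟨hint, ?_⟩
  have key := hac.integral_deriv_mul_eq_sub hac
  have e : ∫ s in (0 : ℝ)..t, (deriv C s * C s + C s * deriv C s) =
      ∫ s in (0 : ℝ)..t, 2 * (c s * r s) := by
    refine intervalIntegral.integral_congr_ae ?_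
    filter_upwards [hr.ae_hasDerivAt_integral] with s hs hm
    have hm' := uIoc_subset_uIcc hm
    have : deriv C s = r s := ((hs hm' 0 left_mem_uIcc).const_add (c 0)).deriv
    rw [this, hcC hm']
    ring
  rw [e] at key
  have e0 : C 0 = c 0 := by simp [hC]
  have et : C t = c t := (hc t (right_mem_Icc.2 ht)).symm
  rw [e0, et] at key
  rw [key]
  ring

/-- The energy identity for a curve `y` in `ℍ¹` whose formal time derivative `R` and Neumann
Laplacian `W` are square integrable. As `y` need not be differentiable in time with values in `ℍ¹`,
the identity is proved for the partial sums of the cosine expansion, where it is the product rule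
for finitely many absolutely continuous coefficients, and the limit is taken by dominated
convergence. -/
theorem energy_identity (hab : a < b) {y y' R W : ℝ → ℝ → R3} {G : ℝ → ℝ} {t : ℝ} (ht : 0 ≤ t)
    (hy : ∀ s ∈ Icc 0 t, HasVecDeriv a b (y s) (y' s))
    (hR : ∀ n i, IntervalIntegrable
      (fun s => ∫ x in Ioo a b, inner ℝ (R s x) (vecMode a b n i x)) volume 0 t)
    (heq : ∀ n i, ∀ s ∈ Icc 0 t, ∫ x in Ioo a b, inner ℝ (y s x) (vecMode a b n i x) =
      (∫ x in Ioo a b, inner ℝ (y 0 x) (vecMode a b n i x)) +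
      ∫ q in (0 : ℝ)..s, ∫ x in Ioo a b, inner ℝ (R q x) (vecMode a b n i x))
    (hG : IntervalIntegrable G volume 0 t)
    (hae : ∀ᵐ s, s ∈ Ioc 0 t → MemLp (R s) 2 (intervalMeasure a b) ∧
      MemLp (W s) 2 (intervalMeasure a b) ∧ IsNeumannLaplacian a b (y' s) (W s) ∧
      ∫ x in Ioo a b, ‖R s x‖ ^ 2 ≤ G s ∧ ∫ x in Ioo a b, ‖W s x‖ ^ 2 ≤ G s) :
    IntervalIntegrable (fun s => ∫ x in Ioo a b, inner ℝ (W s x) (R s x)) volume 0 t ∧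
    ∫ x in Ioo a b, ‖y' t x‖ ^ 2 = (∫ x in Ioo a b, ‖y' 0 x‖ ^ 2) -
      2 * ∫ s in (0 : ℝ)..t, ∫ x in Ioo a b, inner ℝ (W s x) (R s x) := by
  set c : ℕ → Fin 3 → ℝ → ℝ := fun n i s => ∫ x in Ioo a b, inner ℝ (y s x) (vecMode a b n i x)
    with hc
  set r : ℕ → Fin 3 → ℝ → ℝ := fun n i s => ∫ x in Ioo a b, inner ℝ (R s x) (vecMode a b n i x)
    with hr
  set p : ℕ → ℝ → ℝ := fun n s => ∑ i, 2 / (b - a) * eigenvalue a b n * (c n i s * r n i s) with hp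
  have hsq := fun n i => sq_eq_add_integral ht (hR n i) (heq n i)
  have hpi : ∀ n, IntervalIntegrable (p n) volume 0 t := fun n => by
    have := IntervalIntegrable.sum Finset.univ
      (f := fun i s => 2 / (b - a) * eigenvalue a b n * (c n i s * r n i s))
      (fun i _ => (hsq n i).1.const_mul (2 / (b - a) * eigenvalue a b n))
    simpa [hp, Finset.sum_fn] using this
  have hPi : ∀ N, IntervalIntegrable (fun s => ∑ n ∈ Finset.range N, p n s) volume 0 t := by
    intro N
    have := IntervalIntegrable.sum (Finset.range N) (f := p) (fun n _ => hpi n)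
    simpa [Finset.sum_fn] using this
  -- the identity for each coefficient
  have hstep : ∀ n, ∑ i, 2 / (b - a) * eigenvalue a b n * c n i t ^ 2 =
      (∑ i, 2 / (b - a) * eigenvalue a b n * c n i 0 ^ 2) + 2 * ∫ s in (0 : ℝ)..t, p n s := by
    intro n
    have e : ∫ s in (0 : ℝ)..t, p n s =
        ∑ i, 2 / (b - a) * eigenvalue a b n * ∫ s in (0 : ℝ)..t, c n i s * r n i s := by
      simp only [hp]
      rw [intervalIntegral.integral_finsetSum]
      · simp only [intervalIntegral.integral_const_mul]
      · exact fun i _ => (hsq n i).1.const_mul _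
    rw [e, Finset.mul_sum, ← Finset.sum_add_distrib]
    refine Finset.sum_congr rfl fun i _ => ?_
    rw [(hsq n i).2, intervalIntegral.integral_const_mul]
    ring
  -- Parseval's identity and Bessel's inequality at almost every time
  have hgood : ∀ᵐ s, s ∈ Ioc 0 t →
      HasSum (fun n => p n s) (-∫ x in Ioo a b, inner ℝ (W s x) (R s x)) ∧
      ∀ N, ‖∑ n ∈ Finset.range N, p n s‖ ≤ G s := by
    filter_upwards [hae] with s hs hm
    obtain ⟨h1, h2, h3, h4, h5⟩ := hs hm
    have hterm : ∀ n, p n s = -∑ i, cosWeight a b n *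
        ((∫ x in Ioo a b, W s x i * cosMode a b n x) *
          ∫ x in Ioo a b, R s x i * cosMode a b n x) := by
      intro n
      simp only [hp, hc, hr]
      rw [← Finset.sum_neg_distrib]
      refine Finset.sum_congr rfl fun i _ => ?_
      rw [h3.integral_vecMode hab (hy s ⟨hm.1.le, hm.2⟩), ← eigenvalue_mul_cosWeight]
      simp_rw [inner_vecMode]
      ring
    refine ⟨(hasSum_vecCosMode hab h2 h1).neg.congr_fun hterm, fun N => ?_⟩
    have hb1 := sum_le_hasSum (Finset.range N) (fun n _ => Finset.sum_nonneg fun i _ =>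
      mul_nonneg (cosWeight_nonneg hab n) (mul_self_nonneg _)) (hasSum_vecCosMode hab h1 h1)
    have hb2 := sum_le_hasSum (Finset.range N) (fun n _ => Finset.sum_nonneg fun i _ =>
      mul_nonneg (cosWeight_nonneg hab n) (mul_self_nonneg _)) (hasSum_vecCosMode hab h2 h2)
    simp_rw [real_inner_self_eq_norm_sq] at hb1 hb2
    have hb : ‖∑ n ∈ Finset.range N, p n s‖ ≤ 1 / 2 *
        ((∑ n ∈ Finset.range N, ∑ i, cosWeight a b n *
          ((∫ x in Ioo a b, R s x i * cosMode a b n x) *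
            ∫ x in Ioo a b, R s x i * cosMode a b n x)) +
        ∑ n ∈ Finset.range N, ∑ i, cosWeight a b n *
          ((∫ x in Ioo a b, W s x i * cosMode a b n x) *
            ∫ x in Ioo a b, W s x i * cosMode a b n x)) := by
      rw [← Finset.sum_add_distrib, Finset.mul_sum]
      refine (norm_sum_le _ _).trans (Finset.sum_le_sum fun n _ => ?_)
      rw [hterm, norm_neg, ← Finset.sum_add_distrib, Finset.mul_sum]
      refine (norm_sum_le _ _).trans (Finset.sum_le_sum fun i _ => ?_)
      rw [norm_mul, Real.norm_of_nonneg (cosWeight_nonneg hab n), Real.norm_eq_abs]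
      have : ∀ A B : ℝ, |A * B| ≤ 1 / 2 * (B * B + A * A) := fun A B => by
        rw [abs_le]
        constructor <;> nlinarith [sq_nonneg (A + B), sq_nonneg (A - B)]
      refine (mul_le_mul_of_nonneg_left (this _ _) (cosWeight_nonneg hab n)).trans_eq ?_
      ring
    linarith
  have hmeas : ∀ N, AEStronglyMeasurable (fun s => ∑ n ∈ Finset.range N, p n s)
      (volume.restrict (uIoc 0 t)) := fun N => (hPi N).aestronglyMeasurable_restrict_uIoc
  have hlim : ∀ᵐ s, s ∈ uIoc 0 t → Tendsto (fun N => ∑ n ∈ Finset.range N, p n s) atTop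
      (𝓝 (-∫ x in Ioo a b, inner ℝ (W s x) (R s x))) := by
    rw [uIoc_of_le ht]
    filter_upwards [hgood] with s hs hm using (hs hm).1.tendsto_sum_nat
  have hbd : ∀ N, ∀ᵐ s, s ∈ uIoc 0 t → ‖∑ n ∈ Finset.range N, p n s‖ ≤ G s := by
    rw [uIoc_of_le ht]
    intro N
    filter_upwards [hgood] with s hs hm using (hs hm).2 N
  have hint : IntervalIntegrable (fun s => -∫ x in Ioo a b, inner ℝ (W s x) (R s x))
      volume 0 t := by
    rw [intervalIntegrable_iff] at hG ⊢
    refine Integrable.mono' hG (aestronglyMeasurable_of_tendsto_ae atTop hmeas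
      ((ae_restrict_iff' measurableSet_uIoc).2 hlim)) ?_
    rw [ae_restrict_iff' measurableSet_uIoc]
    filter_upwards [hlim, ae_all_iff.2 hbd] with s h1 h2 hm
    exact le_of_tendsto (h1 hm).norm (Eventually.of_forall fun N => h2 N hm)
  have hint' : IntervalIntegrable (fun s => ∫ x in Ioo a b, inner ℝ (W s x) (R s x))
      volume 0 t := by
    simpa only [Pi.neg_def, neg_neg] using hint.neg
  refine ⟨hint', ?_⟩
  have hT := intervalIntegral.tendsto_integral_filter_of_dominated_convergence G
    (Eventually.of_forall hmeas) (Eventually.of_forall hbd) hG hlim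
  have hA : ∀ N, ∑ n ∈ Finset.range N, ∑ i, 2 / (b - a) * eigenvalue a b n * c n i t ^ 2 =
      (∑ n ∈ Finset.range N, ∑ i, 2 / (b - a) * eigenvalue a b n * c n i 0 ^ 2) +
        2 * ∫ s in (0 : ℝ)..t, ∑ n ∈ Finset.range N, p n s := by
    intro N
    rw [intervalIntegral.integral_finsetSum fun n _ => hpi n, Finset.mul_sum,
      ← Finset.sum_add_distrib]
    exact Finset.sum_congr rfl fun n _ => hstep n
  have ht1 := ((hy t (right_mem_Icc.2 ht)).hasSum_dirichlet hab).tendsto_sum_nat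
  have ht0 := ((hy 0 (left_mem_Icc.2 ht)).hasSum_dirichlet hab).tendsto_sum_nat
  have hfin := tendsto_nhds_unique (ht1.congr hA) (ht0.add (hT.const_mul 2))
  rw [hfin, intervalIntegral.integral_neg]
  ring

end

section

/-! ### A nonlinear Grönwall argument -/

/-- If the decay inequality `E' ≤ -γ E` is known only where `E < m`, and `E 0 < m`, then `E` decays
exponentially: it can never reach the level `m`. -/
lemma decay_of_local_decay {E D : ℝ → ℝ} {γ m : ℝ} (hγ : 0 ≤ γ)
    (hD : ∀ T, 0 ≤ T → IntervalIntegrable D volume 0 T)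
    (hE : ∀ t, 0 ≤ t → E t = E 0 + ∫ s in (0 : ℝ)..t, D s) (hE0 : ∀ t, 0 ≤ t → 0 ≤ E t)
    (h : ∀ᵐ s, 0 < s → E s < m → D s ≤ -γ * E s) (h0 : E 0 < m) {t : ℝ} (ht : 0 ≤ t) :
    E t ≤ E 0 * Real.exp (-γ * t) := by
  have hcont : ∀ T, 0 ≤ T → ContinuousOn E (Icc 0 T) := by
    intro T hT
    have h1 : ContinuousOn (fun t => E 0 + ∫ s in (0 : ℝ)..t, D s) (uIcc 0 T) :=
      continuousOn_const.add
        (intervalIntegral.continuousOn_primitive_interval' (hD T hT) left_mem_uIcc)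
    rw [uIcc_of_le hT] at h1
    exact h1.congr fun s hs => hE s hs.1
  have hDi : ∀ p q, 0 ≤ p → 0 ≤ q → IntervalIntegrable D volume p q := fun p q hp hq =>
    (hD p hp).symm.trans (hD q hq)
  have hdiff : ∀ p q, 0 ≤ p → 0 ≤ q → E q - E p = ∫ s in p..q, D s := by
    intro p q hp hq
    rw [hE q hq, hE p hp, ← intervalIntegral.integral_interval_sub_left (hD q hq) (hD p hp)]
    ring
  have hlt : ∀ s, 0 ≤ s → E s < m := by
    by_contra! hcon
    obtain ⟨T, hT, hTm⟩ := hcon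
    have hcl : IsClosed (Icc 0 T ∩ E ⁻¹' Ici m) :=
      (hcont T hT).preimage_isClosed_of_isClosed isClosed_Icc isClosed_Ici
    have hne : (Icc 0 T ∩ E ⁻¹' Ici m).Nonempty := ⟨T, right_mem_Icc.2 hT, hTm⟩
    -- `τ` is the first time at which the level `m` is reached
    obtain ⟨τ, hτ, hmin⟩ := (isCompact_Icc.of_isClosed_subset hcl inter_subset_left).exists_isLeast
      hne
    have hτ0 : 0 ≤ τ := hτ.1.1
    have hneg : ∫ s in (0 : ℝ)..τ, D s ≤ ∫ s in (0 : ℝ)..τ, (0 : ℝ) := by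
      refine intervalIntegral.integral_mono_ae_restrict hτ0 (hD τ hτ0) (by simp) ?_
      rw [EventuallyLE, ae_restrict_iff' measurableSet_Icc]
      have hne0 : ∀ᵐ x : ℝ, x ≠ 0 := by simp [ae_iff, measure_singleton]
      have hneτ : ∀ᵐ x : ℝ, x ≠ τ := by simp [ae_iff, measure_singleton]
      filter_upwards [h, hne0, hneτ] with s hs h0 h1 hm
      have hs1 : s < τ := lt_of_le_of_ne hm.2 h1
      have hsm : E s < m := by
        by_contra! hc
        exact absurd (hmin ⟨⟨hm.1, hm.2.trans hτ.1.2⟩, hc⟩) (not_le.2 hs1)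
      have := hs (lt_of_le_of_ne hm.1 (Ne.symm h0)) hsm
      have := mul_nonneg hγ (hE0 s hm.1)
      linarith
    have hτm : m ≤ E τ := hτ.2
    rw [hE τ hτ0] at hτm
    simp only [intervalIntegral.integral_zero] at hneg
    linarith
  have key := le_gronwallBound_of_liminf_deriv_right_le (f := E) (f' := fun s => -γ * E s)
    (δ := E 0) (K := -γ) (ε := 0) (a := 0) (b := t) (hcont t ht) ?_ le_rfl
    (fun s _ => by simp) t (right_mem_Icc.2 ht)
  · simpa [gronwallBound_ε0] using key
  · intro x hx r hr
    obtain ⟨r', hr1, hr2⟩ := exists_between hr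
    refine Eventually.frequently ?_
    have hcx : ContinuousWithinAt (fun s => -γ * E s) (Ici x) x := by
      have h1 : ContinuousWithinAt E (Icc 0 t) x := hcont t ht x ⟨hx.1, hx.2.le⟩
      have h2 : ContinuousWithinAt E (Ici x) x := by
        refine h1.mono_of_mem_nhdsWithin ?_
        refine mem_of_superset (Icc_mem_nhdsGE hx.2) fun s hs => ⟨hx.1.trans hs.1, hs.2⟩
      exact continuousWithinAt_const.mul h2
    have hev : ∀ᶠ s in 𝓝[≥] x, -γ * E s < r' := hcx.eventually (gt_mem_nhds hr1)
    obtain ⟨u, hu, hus⟩ := mem_nhdsGE_iff_exists_Ico_subset.1 hev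
    filter_upwards [Ioo_mem_nhdsGT hu] with z hz
    have hxz : x < z := hz.1
    rw [hdiff x z hx.1 (hx.1.trans hxz.le)]
    have hle : ∫ s in x..z, D s ≤ ∫ s in x..z, r' := by
      refine intervalIntegral.integral_mono_ae_restrict hxz.le
        (hDi x z hx.1 (hx.1.trans hxz.le)) (by simp) ?_
      rw [EventuallyLE, ae_restrict_iff' measurableSet_Icc]
      have hne0 : ∀ᵐ y : ℝ, y ≠ 0 := by simp [ae_iff, measure_singleton]
      filter_upwards [h, hne0] with s hs h0 hm
      have hs0 : 0 < s := lt_of_le_of_ne (hx.1.trans hm.1) (Ne.symm h0)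
      exact (hs hs0 (hlt s hs0.le)).trans (hus ⟨hm.1, hm.2.trans_lt hz.2⟩ : -γ * E s < r').le
    rw [intervalIntegral.integral_const, smul_eq_mul] at hle
    rw [inv_mul_lt_iff₀ (sub_pos.2 hxz)]
    nlinarith [mul_lt_mul_of_pos_left hr2 (sub_pos.2 hxz)]

variable {a b α β : ℝ} {K : R3} {u₀ : ℝ → R3} {y : ℝ → L2 a b}

/-! ### Measurability in time -/

lemma norm_sq_eq_integral (f : L2 a b) : ‖f‖ ^ 2 = ∫ x in Ioo a b, ‖f x‖ ^ 2 := by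
  rw [← real_inner_self_eq_norm_sq, L2.inner_def]
  simp_rw [real_inner_self_eq_norm_sq]

lemma contDiff_cross {F G : R3 → R3} (hF : ContDiff ℝ 1 F) (hG : ContDiff ℝ 1 G) :
    ContDiff ℝ 1 fun v => cross (F v) (G v) := by
  rw [contDiff_euclidean] at hF hG ⊢
  intro i
  fin_cases i
  · simpa using ((hF 1).mul (hG 2)).sub ((hF 2).mul (hG 1))
  · simpa using ((hF 2).mul (hG 0)).sub ((hF 0).mul (hG 2))
  · simpa using ((hF 0).mul (hG 1)).sub ((hF 1).mul (hG 0))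

lemma contDiff_lowerField (β : ℝ) (K : R3) : ContDiff ℝ 1 (lowerField β K) := by
  refine ContDiff.add (ContDiff.neg (ContDiff.const_smul β ?_)) contDiff_const
  have h := contDiff_euclidean.1 (contDiff_id (𝕜 := ℝ) (E := R3) (n := 1))
  rw [contDiff_euclidean]
  intro i
  fin_cases i
  · simpa using contDiff_const
  · simpa using h 1
  · simpa using h 2

lemma contDiff_id_r3 : ContDiff ℝ 1 (fun v : R3 => v) := contDiff_id

/-- A smooth function of a continuous curve of unit vector fields is weakly continuous, as it is
Lipschitz on the unit ball. -/
lemma continuousOn_integral_inner {S : Set ℝ} {Φ : R3 → R3} {φ : ℝ → R3} (hΦ : ContDiff ℝ 1 Φ)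
    (hy : ContinuousOn y S) (h1 : ∀ t ∈ S, ∀ᵐ x ∂(intervalMeasure a b), ‖y t x‖ = 1)
    (hφ : MemLp φ 2 (intervalMeasure a b)) :
    ContinuousOn (fun t => ∫ x in Ioo a b, inner ℝ (Φ (y t x)) (φ x)) S := by
  obtain ⟨L, hL⟩ := (hΦ.contDiffOn (s := Metric.closedBall (0 : R3) 1)).exists_lipschitzOnWith
    (by simp) (convex_closedBall _ _) (isCompact_closedBall _ _)
  have hm : ∀ t ∈ S, MemLp (fun x => Φ (y t x)) 2 (intervalMeasure a b) := by
    intro t ht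
    obtain ⟨C, hC⟩ := (isCompact_closedBall (0 : R3) 1).exists_bound_of_continuousOn
      hΦ.continuous.continuousOn
    refine MemLp.of_bound (hΦ.continuous.comp_aestronglyMeasurable (Lp.aestronglyMeasurable _)) C ?_
    filter_upwards [h1 t ht] with x hx
    exact hC _ (by simp [hx])
  intro t ht
  rw [ContinuousWithinAt, tendsto_iff_norm_sub_tendsto_zero]
  have hbound : ∀ s ∈ S, ‖(∫ x in Ioo a b, inner ℝ (Φ (y s x)) (φ x)) -
      ∫ x in Ioo a b, inner ℝ (Φ (y t x)) (φ x)‖ ≤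
      L * (‖y s - y t‖ * √(∫ x in Ioo a b, ‖φ x‖ ^ 2)) := by
    intro s hs
    rw [← integral_sub (integrable_inner_of_memLp (hm s hs) hφ)
      (integrable_inner_of_memLp (hm t ht) hφ)]
    have hd : MemLp (fun x => (y s - y t : L2 a b) x) 2 (intervalMeasure a b) := Lp.memLp _
    have hcs := integral_norm_mul_norm_le hd hφ
    rw [← norm_sq_eq_integral, Real.sqrt_sq (norm_nonneg _)] at hcs
    refine le_trans ?_ (mul_le_mul_of_nonneg_left hcs L.2)
    rw [← integral_const_mul]
    refine norm_integral_le_of_norm_le ((hd.norm.integrable_mul hφ.norm).const_mul _) ?_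
    filter_upwards [h1 s hs, h1 t ht, Lp.coeFn_sub (y s) (y t)] with x hx1 hx2 hx3
    rw [hx3, ← inner_sub_left, Pi.sub_apply, ← mul_assoc]
    refine (norm_inner_le_norm _ _).trans (mul_le_mul_of_nonneg_right ?_ (norm_nonneg _))
    have := hL.dist_le_mul (y s x) (by simp [hx1]) (y t x) (by simp [hx2])
    rwa [dist_eq_norm, dist_eq_norm] at this
  refine squeeze_zero' (Eventually.of_forall fun _ => norm_nonneg _)
    (eventually_mem_nhdsWithin.mono hbound) ?_
  have h2 := tendsto_iff_norm_sub_tendsto_zero.1 (hy t ht)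
  simpa using (h2.mul_const (√(∫ x in Ioo a b, ‖φ x‖ ^ 2))).const_mul (L : ℝ)

lemma memLp_cross_continuous {φ : ℝ → R3} (hφ : Continuous φ) (v : L2 a b) :
    MemLp (fun x => cross (φ x) (v x)) 2 (intervalMeasure a b) := by
  obtain ⟨C, hC⟩ := isCompact_Icc.exists_bound_of_continuousOn (hφ.continuousOn (s := Icc a b))
  refine memLp_cross_of_bdd (C := C) hφ.aestronglyMeasurable ?_ (Lp.memLp v)
  filter_upwards [ae_restrict_mem measurableSet_Ioo] with x hx using hC x (Ioo_subset_Icc_self hx)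

/-- Multiplication by a continuous function, in the sense of the vector product, on `ℍ`. -/
def crossL2 {φ : ℝ → R3} (hφ : Continuous φ) (v : L2 a b) : L2 a b :=
  (memLp_cross_continuous hφ v).toLp _

lemma continuous_crossL2 {φ : ℝ → R3} (hφ : Continuous φ) :
    Continuous (crossL2 hφ : L2 a b → L2 a b) := by
  obtain ⟨C, hC⟩ := isCompact_Icc.exists_bound_of_continuousOn (hφ.continuousOn (s := Icc a b))
  refine (LipschitzWith.of_dist_le_mul (K := C.toNNReal) fun v w => ?_).continuous
  rw [dist_eq_norm, dist_eq_norm]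
  refine Lp.norm_le_mul_norm_of_ae_le_mul ?_
  filter_upwards [Lp.coeFn_sub v w, Lp.coeFn_sub (crossL2 hφ v) (crossL2 hφ w),
    (memLp_cross_continuous hφ v).coeFn_toLp, (memLp_cross_continuous hφ w).coeFn_toLp,
    ae_restrict_mem measurableSet_Ioo] with x h1 h2 h3 h4 hm
  rw [h1, h2, Pi.sub_apply, Pi.sub_apply, crossL2, crossL2, h3, h4]
  have e : cross (φ x) (v x) - cross (φ x) (w x) = cross (φ x) (v x - w x) := by
    refine r3_ext ?_ ?_ ?_ <;> simp <;> ring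
  rw [e]
  refine (norm_cross_le _ _).trans (mul_le_mul_of_nonneg_right ?_ (norm_nonneg _))
  exact (hC x (Ioo_subset_Icc_self hm)).trans (Real.le_coe_toNNReal C)

lemma integral_inner_crossL2 {φ : ℝ → R3} (hφ : Continuous φ) (f v : L2 a b) :
    inner ℝ f (crossL2 hφ v) = ∫ x in Ioo a b, inner ℝ (f x) (cross (φ x) (v x)) := by
  rw [L2.inner_def]
  refine integral_congr_ae ?_
  filter_upwards [(memLp_cross_continuous hφ v).coeFn_toLp] with x hx
  rw [crossL2, hx]

lemma integral_inner_toLp {φ : ℝ → R3} (hφ : MemLp φ 2 (intervalMeasure a b)) (f : L2 a b) :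
    inner ℝ f (hφ.toLp φ) = ∫ x in Ioo a b, inner ℝ (f x) (φ x) := by
  rw [L2.inner_def]
  refine integral_congr_ae ?_
  filter_upwards [hφ.coeFn_toLp] with x hx
  rw [hx]

/-! ### Solutions -/

/-- The equation, with the pairings written as integrals against square integrable fields: at almost
every time the solution has a square integrable Neumann Laplacian `W`. -/
theorem IsSolution.exists_laplacian (hab : a < b) (hα : 0 ≤ α) (hβ : 0 ≤ β)
    (hy : IsSolution a b α β K u₀ y) :
    ∃ W : ℝ → ℝ → R3, ∀ T, 0 ≤ T → ∃ G : ℝ → ℝ, IntervalIntegrable G volume 0 T ∧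
      (∀ φ φ' : ℝ → R3, Continuous φ → HasVecDeriv a b φ φ' →
        IntervalIntegrable (fun s => ∫ x in Ioo a b, inner ℝ (rhsField α β K (y s x) (W s x)) (φ x))
          volume 0 T ∧
        ∀ s ∈ Icc 0 T, ∫ x in Ioo a b, inner ℝ (y s x) (φ x) =
          (∫ x in Ioo a b, inner ℝ (u₀ x) (φ x)) + ∫ q in (0 : ℝ)..s, ∫ x in Ioo a b,
            inner ℝ (rhsField α β K (y q x) (W q x)) (φ x)) ∧
      ∀ᵐ s, s ∈ Ioc 0 T →
        MemLp (fun x => rhsField α β K (y s x) (W s x)) 2 (intervalMeasure a b) ∧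
        MemLp (W s) 2 (intervalMeasure a b) ∧
        IsNeumannLaplacian a b (weakDeriv a b (y s)) (W s) ∧
        ∫ x in Ioo a b, ‖rhsField α β K (y s x) (W s x)‖ ^ 2 ≤ G s ∧
        ∫ x in Ioo a b, ‖W s x‖ ^ 2 ≤ G s := by
  obtain ⟨g, hg2, hgeq⟩ := hy.sq_integrable
  rw [ae_restrict_iff' measurableSet_Ioi] at hgeq
  set W : ℝ → ℝ → R3 := fun s => recoveredLaplacian (y s) (weakDeriv a b (y s)) (g s) with hW
  refine ⟨W, fun T hT => ?_⟩
  obtain ⟨C, hC⟩ := hy.bounded T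
  have hderiv : ∀ s, 0 ≤ s → HasVecDeriv a b (y s) (weakDeriv a b (y s)) := fun s hs =>
    (hy.memH1 s hs).hasVecDeriv hab
  set P : ℝ → ℝ := fun s => 2 * ‖g s‖ ^ 2 + 12 * ((b - a) * ‖g s‖ ^ 2 + (C ^ 2) ^ 2) * C ^ 2 with hP
  set G : ℝ → ℝ := fun s => P s + 2 * (1 + α) ^ 2 * (P s + (β + ‖K‖) ^ 2 * (b - a)) with hG
  have hl : 0 < b - a := sub_pos.2 hab
  have hP0 : ∀ s, 0 ≤ P s := fun s => by positivity
  have hgi : IntervalIntegrable (fun s => ‖g s‖ ^ 2) volume 0 T := by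
    rw [intervalIntegrable_iff_integrableOn_Ioc_of_le hT]
    exact (memLp_two_iff_integrable_sq_norm (hg2 T).1).1 (hg2 T)
  have hPi : IntervalIntegrable P volume 0 T :=
    (hgi.const_mul 2).add ((((hgi.const_mul (b - a)).add
      intervalIntegrable_const).const_mul 12).mul_const (C ^ 2))
  have hGi : IntervalIntegrable G volume 0 T :=
    hPi.add ((hPi.add intervalIntegrable_const).const_mul _)
  have hae : ∀ᵐ s, s ∈ Ioc 0 T →
      MemLp (fun x => rhsField α β K (y s x) (W s x)) 2 (intervalMeasure a b) ∧
      MemLp (W s) 2 (intervalMeasure a b) ∧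
      IsNeumannLaplacian a b (weakDeriv a b (y s)) (W s) ∧
      ∫ x in Ioo a b, ‖rhsField α β K (y s x) (W s x)‖ ^ 2 ≤ G s ∧
      ∫ x in Ioo a b, ‖W s x‖ ^ 2 ≤ G s := by
    filter_upwards [hgeq] with s hs hm
    have hs0 : 0 ≤ s := hm.1.le
    have hu := hderiv s hs0
    have h1 := hy.saturated s hs0
    have hgm : MemLp (g s) 2 (intervalMeasure a b) := Lp.memLp _
    have hN := isNeumannLaplacian_recoveredLaplacian hab hu h1 hgm (hs hm.1)
    obtain ⟨hW2, hWb⟩ := memLp_recoveredLaplacian hab hu h1 hgm (hs hm.1)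
    have hR := memLp_rhsField (K := K) hα hβ (hu.memLp hab.le 2).1 h1 hW2
    have hA0 : 0 ≤ ∫ x in Ioo a b, ‖weakDeriv a b (y s) x‖ ^ 2 :=
      integral_nonneg fun _ => by positivity
    have hAC : ∫ x in Ioo a b, ‖weakDeriv a b (y s) x‖ ^ 2 ≤ C ^ 2 := by
      have h2 : normH1 a b (y s) ^ 2 ≤ C ^ 2 :=
        pow_le_pow_left₀ (Real.sqrt_nonneg _) (hC s ⟨hs0, hm.2⟩) 2
      rw [normH1_sq] at h2
      have h3 : 0 ≤ ∫ x in Ioo a b, ‖y s x‖ ^ 2 := integral_nonneg fun _ => by positivity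
      linarith
    have hWP : ∫ x in Ioo a b, ‖W s x‖ ^ 2 ≤ P s := by
      refine hWb.trans ?_
      rw [← norm_sq_eq_integral]
      simp only [hP]
      gcongr
    refine ⟨hR, hW2, hN, ?_, ?_⟩
    · have hint : Integrable (fun x => 2 * (1 + α) ^ 2 * (‖W s x‖ ^ 2 + (β + ‖K‖) ^ 2))
          (intervalMeasure a b) :=
        ((integrable_norm_sq hW2).add (integrable_const _)).const_mul _
      have h2 : ∫ x in Ioo a b, ‖rhsField α β K (y s x) (W s x)‖ ^ 2 ≤
          ∫ x in Ioo a b, 2 * (1 + α) ^ 2 * (‖W s x‖ ^ 2 + (β + ‖K‖) ^ 2) := by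
        refine integral_mono_ae (integrable_norm_sq hR) hint ?_
        filter_upwards [h1] with x hx
        have h3 := pow_le_pow_left₀ (norm_nonneg _)
          (norm_rhsField_le hα hβ K hx (W s x)) 2
        have h4 : (‖W s x‖ + (β + ‖K‖)) ^ 2 ≤ 2 * (‖W s x‖ ^ 2 + (β + ‖K‖) ^ 2) := by
          nlinarith [sq_nonneg (‖W s x‖ - (β + ‖K‖))]
        refine h3.trans ?_
        rw [mul_pow]
        calc (1 + α) ^ 2 * (‖W s x‖ + (β + ‖K‖)) ^ 2
            ≤ (1 + α) ^ 2 * (2 * (‖W s x‖ ^ 2 + (β + ‖K‖) ^ 2)) :=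
              mul_le_mul_of_nonneg_left h4 (by positivity)
          _ = _ := by ring
      rw [integral_const_mul, integral_add (integrable_norm_sq hW2) (integrable_const _)] at h2
      simp only [integral_const, MeasurableSet.univ, measureReal_restrict_apply, univ_inter,
        Real.volume_real_Ioo_of_le hab.le, smul_eq_mul] at h2
      refine h2.trans ?_
      simp only [hG]
      have h5 : 2 * (1 + α) ^ 2 * ((∫ x in Ioo a b, ‖W s x‖ ^ 2) + (b - a) * (β + ‖K‖) ^ 2) ≤
          2 * (1 + α) ^ 2 * (P s + (β + ‖K‖) ^ 2 * (b - a)) := by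
        rw [mul_comm (b - a)]
        gcongr
      linarith [hP0 s]
    · have : 0 ≤ 2 * (1 + α) ^ 2 * (P s + (β + ‖K‖) ^ 2 * (b - a)) :=
        mul_nonneg (by positivity) (add_nonneg (hP0 s) (by positivity))
      simp only [hG]
      linarith
  refine ⟨G, hGi, fun φ φ' hφc hφ => ?_, hae⟩
  have hφ2 := hφ.memLp hab.le 2
  -- the integrand of the equation, and a form of it that is measurable in time
  have hform : ∀ᵐ s, s ∈ Ioc 0 T →
      ((crossLaplacian a b (y s) (y s) φ +
            ∫ x in Ioo a b, inner ℝ (cross (y s x) (lowerField β K (y s x))) (φ x)) -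
          α * (crossCrossLaplacian a b (y s) (y s) (y s) φ +
            ∫ x in Ioo a b,
              inner ℝ (cross (y s x) (cross (y s x) (lowerField β K (y s x)))) (φ x))) =
        ∫ x in Ioo a b, inner ℝ (rhsField α β K (y s x) (W s x)) (φ x) := by
    filter_upwards [hae] with s hs hm
    obtain ⟨-, h2, h3, -, -⟩ := hs hm
    exact integral_inner_rhsField hab hβ K (hderiv s hm.1.le) (hy.saturated s hm.1.le) h2 h3 hφ
  have hmeas : AEStronglyMeasurable
      (fun s => ∫ x in Ioo a b, inner ℝ (rhsField α β K (y s x) (W s x)) (φ x))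
      (volume.restrict (Ioc 0 T)) := by
    have hsub : Ioc (0 : ℝ) T ⊆ Ici 0 := fun s hs => hs.1.le
    have hyc := hy.continuousOn.mono hsub
    have hsat : ∀ t ∈ Ioc (0 : ℝ) T, ∀ᵐ x ∂(intervalMeasure a b), ‖y t x‖ = 1 := fun t ht =>
      hy.saturated t ht.1.le
    have hcd := contDiff_cross contDiff_id_r3 (contDiff_lowerField β K)
    have c1 := (continuousOn_integral_inner hcd hyc hsat hφ2).aestronglyMeasurable (μ := volume)
      measurableSet_Ioc
    have c2 := (continuousOn_integral_inner (contDiff_cross contDiff_id_r3 hcd) hyc hsat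
      hφ2).aestronglyMeasurable (μ := volume) measurableSet_Ioc
    have c3 : AEStronglyMeasurable (fun s => inner ℝ (g s) (hφ2.toLp φ))
      (volume.restrict (Ioc 0 T)) := (hg2 T).1.inner aestronglyMeasurable_const
    have c4 : AEStronglyMeasurable (fun s => inner ℝ (g s) (crossL2 hφc (y s)))
      (volume.restrict (Ioc 0 T)) := (hg2 T).1.inner
        ((continuous_crossL2 hφc).comp_aestronglyMeasurable
          (hyc.aestronglyMeasurable measurableSet_Ioc))
    refine ((c3.add c1).sub ((c4.add c2).const_mul α)).congr ?_
    rw [EventuallyEq, ae_restrict_iff' measurableSet_Ioc]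
    filter_upwards [hform, hgeq] with s hs hs' hm
    rw [← hs hm, hs' hm.1 φ (hφ.memH1 hab)]
    have e : crossCrossLaplacian a b (y s) (y s) (y s) φ =
        ∫ x in Ioo a b, inner ℝ (g s x) (cross (φ x) (y s x)) :=
      hs' hm.1 (fun x => cross (φ x) (y s x)) ((hφ.cross hab.le (hderiv s hm.1.le)).memH1 hab)
    rw [e]
    simp only [Pi.add_apply, Pi.sub_apply, integral_inner_toLp, integral_inner_crossL2]
  constructor
  · rw [intervalIntegrable_iff_integrableOn_Ioc_of_le hT] at hGi ⊢
    refine Integrable.mono' ((hGi.add (integrable_const (∫ x in Ioo a b, ‖φ x‖ ^ 2))).const_mul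
      (1 / 2)) hmeas ?_
    rw [ae_restrict_iff' measurableSet_Ioc]
    filter_upwards [hae] with s hs hm
    obtain ⟨h1, -, -, h4, -⟩ := hs hm
    have h5 : ‖∫ x in Ioo a b, inner ℝ (rhsField α β K (y s x) (W s x)) (φ x)‖ ≤
        ∫ x in Ioo a b, 1 / 2 * (‖rhsField α β K (y s x) (W s x)‖ ^ 2 + ‖φ x‖ ^ 2) := by
      refine norm_integral_le_of_norm_le (((integrable_norm_sq h1).add
        (integrable_norm_sq hφ2)).const_mul _) (ae_of_all _ fun x => ?_)
      refine (norm_inner_le_norm _ _).trans ?_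
      nlinarith [sq_nonneg (‖rhsField α β K (y s x) (W s x)‖ - ‖φ x‖)]
    rw [integral_const_mul, integral_add (integrable_norm_sq h1) (integrable_norm_sq hφ2)] at h5
    simp only [Pi.add_apply]
    linarith
  · intro s hs
    rw [hy.equation s hs.1 φ (hφ.memH1 hab)]
    congr 1
    refine intervalIntegral.integral_congr_ae ?_
    filter_upwards [hform] with q hq hm
    rw [uIoc_of_le hs.1] at hm
    exact hq ⟨hm.1, hm.2.trans hs.2⟩

/-- A solution attains its initial value: the equation at time zero says so in the dual of `ℍ¹`. -/
lemma IsSolution.initial (hab : a < b) (hy : IsSolution a b α β K u₀ y) (hu₀ : MemH1 a b u₀) :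
    y 0 =ᵐ[intervalMeasure a b] u₀ := by
  have h0 := (hy.memH1 0 le_rfl).hasVecDeriv hab
  have hd := h0.sub (hu₀.hasVecDeriv hab)
  have hdm := hd.memLp hab.le 2
  have key := hy.equation 0 le_rfl _ (hd.memH1 hab)
  rw [intervalIntegral.integral_same, add_zero, ← sub_eq_zero,
    ← integral_sub (integrable_inner_of_memLp (h0.memLp hab.le 2) hdm)
      (integrable_inner_of_memLp hu₀.1 hdm)] at key
  simp_rw [← inner_sub_left, real_inner_self_eq_norm_sq] at key
  rw [integral_eq_zero_iff_of_nonneg (fun _ => by positivity) (integrable_norm_sq hdm)] at key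
  filter_upwards [key] with x hx
  simpa [sub_eq_zero] using hx

end

section

variable {a b α β : ℝ} {u₀ : ℝ → R3} {y : ℝ → L2 a b} {H : R3}

/-! ### Decay towards the applied field -/

lemma norm_unit (hH : H ≠ 0) : ‖‖H‖⁻¹ • H‖ = 1 := by
  rw [norm_smul, norm_inv, norm_norm, inv_mul_cancel₀ (norm_ne_zero_iff.2 hH)]

lemma integral_norm_sub_sq (hab : a < b) {u : ℝ → R3} {ζ : R3} (hζ : ‖ζ‖ = 1)
    (hu : MemLp u 2 (intervalMeasure a b)) (h1 : ∀ᵐ x ∂(intervalMeasure a b), ‖u x‖ = 1) :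
    ∫ x in Ioo a b, ‖u x - ζ‖ ^ 2 = 2 * (b - a) - 2 * ∫ x in Ioo a b, inner ℝ (u x) ζ := by
  have hζm : MemLp (fun _ : ℝ => ζ) 2 (intervalMeasure a b) := memLp_const _
  have hi := integrable_inner_of_memLp hu hζm
  have e : ∫ x in Ioo a b, ‖u x - ζ‖ ^ 2 = ∫ x in Ioo a b, (2 - 2 * inner ℝ (u x) ζ) := by
    refine integral_congr_ae ?_
    filter_upwards [h1] with x hx
    rw [norm_sub_sq_real, hx, hζ]
    ring
  rw [e, integral_sub (integrable_const _) (hi.const_mul 2), integral_const_mul]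
  simp [Real.volume_real_Ioo_of_le hab.le, mul_comm]

/-- The interpolation inequality turns smallness in `ℍ¹` into a pointwise bound. -/
lemma ae_norm_le_one {k : ℝ} (hk : IsInterpolationConstant a b k) {u : ℝ → R3} (hu : MemH1 a b u)
    (h : normH1 a b u < 1 / k) : ∀ᵐ x ∂(intervalMeasure a b), ‖u x‖ ≤ 1 := by
  have hk0 := hk.1
  have hN0 : 0 ≤ normH1 a b u := Real.sqrt_nonneg _
  have hle : normL2 a b u ≤ normH1 a b u :=
    Real.sqrt_le_sqrt (le_add_of_nonneg_right (integral_nonneg fun _ => by positivity))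
  filter_upwards [hk.2 u hu] with x hx
  refine hx.trans ?_
  have h1 : √(normL2 a b u) ≤ √(normH1 a b u) := Real.sqrt_le_sqrt hle
  have h2 : √(normH1 a b u) * √(normH1 a b u) = normH1 a b u := Real.mul_self_sqrt hN0
  have h3 : k * normH1 a b u < 1 := by
    rw [lt_div_iff₀ hk0] at h
    linarith
  calc k * √(normL2 a b u) * √(normH1 a b u)
      ≤ k * √(normH1 a b u) * √(normH1 a b u) := by gcongr
    _ = k * normH1 a b u := by rw [mul_assoc, h2]
    _ ≤ 1 := h3.le

lemma decayRate_pos (hα : 0 < α)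
    (hH : max ((4 * β + 4 * α * β) / (3 * α)) ((2 * β + 4 * α * β - α) / α) < ‖H‖) :
    0 < decayRate α β H := by
  obtain ⟨h1, h2⟩ := max_lt_iff.1 hH
  rw [div_lt_iff₀ (by positivity)] at h1 h2
  refine lt_min ?_ ?_ <;> nlinarith

/-- The squared `ℍ¹` distance of a solution from the direction of the field has an integrable
derivative, which satisfies the decay inequality as long as the distance is less than `1 / k`. -/
theorem IsSolution.exists_deriv_normH1_sq (hab : a < b) (hα : 0 < α) (hβ : 0 < β) {k : ℝ}
    (hk : IsInterpolationConstant a b k) (hH : H ≠ 0) (hu₀ : MemH1 a b u₀)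
    (hy : IsSolution a b α β (appliedField β H) u₀ y) :
    ∃ D : ℝ → ℝ, (∀ T, 0 ≤ T → IntervalIntegrable D volume 0 T) ∧
      (∀ t, 0 ≤ t → normH1 a b (fun x => y t x - ‖H‖⁻¹ • H) ^ 2 =
        normH1 a b (fun x => y 0 x - ‖H‖⁻¹ • H) ^ 2 + ∫ s in (0 : ℝ)..t, D s) ∧
      ∀ᵐ s, 0 < s → normH1 a b (fun x => y s x - ‖H‖⁻¹ • H) ^ 2 < (1 / k) ^ 2 →
        D s ≤ -decayRate α β H * normH1 a b (fun x => y s x - ‖H‖⁻¹ • H) ^ 2 := by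
  obtain ⟨W, hW⟩ := hy.exists_laplacian hab hα.le hβ.le
  set ζ := ‖H‖⁻¹ • H with hζdef
  have hζ : ‖ζ‖ = 1 := norm_unit hH
  set K := appliedField β H with hK
  have hderiv : ∀ s, 0 ≤ s → HasVecDeriv a b (y s) (weakDeriv a b (y s)) := fun s hs =>
    (hy.memH1 s hs).hasVecDeriv hab
  have hz : ∀ s, 0 ≤ s → HasVecDeriv a b (fun x => y s x - ζ) (weakDeriv a b (y s)) := fun s hs =>
    ((hderiv s hs).sub (HasVecDeriv.const ζ)).congr ae_eq_rfl (ae_of_all _ fun x => by simp)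
  have hE : ∀ s, 0 ≤ s → normH1 a b (fun x => y s x - ζ) ^ 2 =
      (∫ x in Ioo a b, ‖y s x - ζ‖ ^ 2) + ∫ x in Ioo a b, ‖weakDeriv a b (y s) x‖ ^ 2 := fun s hs =>
    (hz s hs).normH1_sq hab
  set R : ℝ → ℝ → R3 := fun s x => rhsField α β K (y s x) (W s x) with hR
  have hinit : ∀ φ : ℝ → R3, ∫ x in Ioo a b, inner ℝ (u₀ x) (φ x) =
      ∫ x in Ioo a b, inner ℝ (y 0 x) (φ x) := fun φ => by
    refine integral_congr_ae ?_
    filter_upwards [hy.initial hab hu₀] with x hx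
    rw [hx]
  set D : ℝ → ℝ := fun s => 2 * (-(∫ x in Ioo a b, inner ℝ (W s x) (R s x)) -
    ∫ x in Ioo a b, inner ℝ (R s x) ζ) with hD
  have hmain : ∀ t, 0 ≤ t → IntervalIntegrable D volume 0 t ∧
      normH1 a b (fun x => y t x - ζ) ^ 2 =
        normH1 a b (fun x => y 0 x - ζ) ^ 2 + ∫ s in (0 : ℝ)..t, D s := by
    intro t ht
    obtain ⟨G, hGi, hφ, hae⟩ := hW t ht
    obtain ⟨i1, e1⟩ := energy_identity hab (y := fun s x => y s x)
      (y' := fun s => weakDeriv a b (y s)) (R := R) (W := W) ht (fun s hs => hderiv s hs.1)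
      (fun n i => (hφ _ _ (continuous_vecMode n i) (hasVecDeriv_vecMode hab.le n i)).1)
      (fun n i s hs => by
        rw [(hφ _ _ (continuous_vecMode n i) (hasVecDeriv_vecMode hab.le n i)).2 s hs, hinit])
      hGi hae
    obtain ⟨i2, e2⟩ := hφ (fun _ => ζ) _ continuous_const (HasVecDeriv.const ζ)
    have e3 := e2 t (right_mem_Icc.2 ht)
    rw [hinit] at e3
    have i1n : IntervalIntegrable (fun s => -∫ x in Ioo a b, inner ℝ (W s x) (R s x)) volume 0 t :=
      i1.neg
    refine ⟨(i1n.sub i2).const_mul 2, ?_⟩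
    have e4 : ∫ s in (0 : ℝ)..t, D s =
        2 * (-(∫ s in (0 : ℝ)..t, ∫ x in Ioo a b, inner ℝ (W s x) (R s x)) -
          ∫ s in (0 : ℝ)..t, ∫ x in Ioo a b, inner ℝ (R s x) ζ) := by
      simp only [hD]
      rw [intervalIntegral.integral_const_mul, ← intervalIntegral.integral_neg,
        ← intervalIntegral.integral_sub i1n i2]
    rw [hE t ht, hE 0 le_rfl, e4,
      integral_norm_sub_sq hab hζ ((hderiv t ht).memLp hab.le 2) (hy.saturated t ht),
      integral_norm_sub_sq hab hζ ((hderiv 0 le_rfl).memLp hab.le 2) (hy.saturated 0 le_rfl),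
      e1, e3]
    ring
  refine ⟨D, fun T hT => (hmain T hT).1, fun t ht => (hmain t ht).2, ?_⟩
  have hall : ∀ n : ℕ, ∀ᵐ s, s ∈ Ioc 0 (n : ℝ) → MemLp (W s) 2 (intervalMeasure a b) ∧
      IsNeumannLaplacian a b (weakDeriv a b (y s)) (W s) := fun n => by
    obtain ⟨G, -, -, hae⟩ := hW n n.cast_nonneg
    filter_upwards [hae] with s hs hm using ⟨(hs hm).2.1, (hs hm).2.2.1⟩
  filter_upwards [ae_all_iff.2 hall] with s hs hs0 hsm
  obtain ⟨n, hn⟩ := exists_nat_ge s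
  obtain ⟨hW2, hN⟩ := hs n ⟨hs0, hn⟩
  have hsm' : normH1 a b (fun x => y s x - ζ) < 1 / k :=
    lt_of_pow_lt_pow_left₀ 2 (one_div_nonneg.2 hk.1.le) hsm
  have hz1 := ae_norm_le_one hk ((hz s hs0.le).memH1 hab) hsm'
  have key := dissipation hab hα.le hβ.le hH (hderiv s hs0.le) (hy.saturated s hs0.le) hW2 hN hz1
  rw [← hζdef, ← hK] at key
  rw [hE s hs0.le]
  set A := ∫ x in Ioo a b, ‖weakDeriv a b (y s) x‖ ^ 2 with hA
  set B := ∫ x in Ioo a b, ‖y s x - ζ‖ ^ 2 with hB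
  have hA0 : 0 ≤ A := integral_nonneg fun _ => by positivity
  have hB0 : 0 ≤ B := integral_nonneg fun _ => by positivity
  have g1 : decayRate α β H ≤ α * ‖H‖ + α - 2 * β - 4 * α * β := min_le_left _ _
  have g2 : decayRate α β H ≤ 3 / 2 * α * ‖H‖ - 2 * β - 2 * α * β := min_le_right _ _
  have g3 := mul_le_mul_of_nonneg_right g1 hA0
  have g4 := mul_le_mul_of_nonneg_right g2 hB0
  simp only [hD]
  linarith

end

end LandauLifshitz

end

theorem lemma10p3 (a b α β : ℝ) (hab : a < b) (hα : 0 < α) (hβ : 0 < β) :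
    LandauLifshitz.IsInterpolationConstant a b (2 * max 1 (1 / √(b - a))) ∧
    ∀ k : ℝ, LandauLifshitz.IsInterpolationConstant a b k →
    ∀ H : LandauLifshitz.R3,
      max ((4 * β + 4 * α * β) / (3 * α)) ((2 * β + 4 * α * β - α) / α) < ‖H‖ →
    ∀ u₀ : ℝ → LandauLifshitz.R3, LandauLifshitz.MemH1 a b u₀ →
      (∀ᵐ x ∂(LandauLifshitz.intervalMeasure a b), ‖u₀ x‖ = 1) →
      LandauLifshitz.normH1 a b (fun x => u₀ x - ‖H‖⁻¹ • H) < 1 / k →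
    ∀ y : ℝ → LandauLifshitz.L2 a b,
      LandauLifshitz.IsSolution a b α β (LandauLifshitz.appliedField β H) u₀ y →
    0 < LandauLifshitz.decayRate α β H ∧
    (∀ t : ℝ, 0 ≤ t →
      LandauLifshitz.normH1 a b (fun x => y t x - ‖H‖⁻¹ • H) ≤
        LandauLifshitz.normH1 a b (fun x => u₀ x - ‖H‖⁻¹ • H) *
          Real.exp (-(1 / 2) * LandauLifshitz.decayRate α β H * t)) ∧
    Filter.Tendsto (fun t : ℝ => LandauLifshitz.normH1 a b (fun x => y t x - ‖H‖⁻¹ • H))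
      Filter.atTop (nhds 0) := by
  open LandauLifshitz in
  refine ⟨isInterpolationConstant hab, ?_⟩
  intro k hk H hH u₀ hu₀ _ hsmall y hy
  have hγ := decayRate_pos hα hH
  have hH0 : H ≠ 0 := by
    rintro rfl
    have h1 := (le_max_left _ _).trans_lt hH
    rw [norm_zero] at h1
    have h2 : 0 < (4 * β + 4 * α * β) / (3 * α) := by positivity
    linarith
  have hinit : normH1 a b (fun x => y 0 x - ‖H‖⁻¹ • H) =
      normH1 a b (fun x => u₀ x - ‖H‖⁻¹ • H) := by
    have h1 := (hu₀.hasVecDeriv hab).sub (HasVecDeriv.const (‖H‖⁻¹ • H))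
    have h2 := h1.congr (v := fun x => y 0 x - ‖H‖⁻¹ • H) (by
      filter_upwards [hy.initial hab hu₀] with x hx
      rw [hx]) ae_eq_rfl
    have e : normH1 a b (fun x => y 0 x - ‖H‖⁻¹ • H) ^ 2 =
        normH1 a b (fun x => u₀ x - ‖H‖⁻¹ • H) ^ 2 := by
      rw [h1.normH1_sq hab, h2.normH1_sq hab]
      congr 1
      refine integral_congr_ae ?_
      filter_upwards [hy.initial hab hu₀] with x hx
      rw [hx]
    exact (pow_left_inj₀ (Real.sqrt_nonneg _) (Real.sqrt_nonneg _) two_ne_zero).1 e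
  obtain ⟨D, hD1, hD2, hD3⟩ := hy.exists_deriv_normH1_sq hab hα hβ hk hH0 hu₀
  have hdecay : ∀ t : ℝ, 0 ≤ t → normH1 a b (fun x => y t x - ‖H‖⁻¹ • H) ≤
      normH1 a b (fun x => u₀ x - ‖H‖⁻¹ • H) * Real.exp (-(1 / 2) * decayRate α β H * t) := by
    intro t ht
    have key := decay_of_local_decay (E := fun t => normH1 a b (fun x => y t x - ‖H‖⁻¹ • H) ^ 2)
      hγ.le hD1 hD2 (fun t _ => by positivity) hD3
      (pow_lt_pow_left₀ (hinit.trans_lt hsmall) (Real.sqrt_nonneg _) two_ne_zero) ht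
    rw [hinit] at key
    refine le_of_sq_le_sq (key.trans_eq ?_) (mul_nonneg (Real.sqrt_nonneg _) (Real.exp_pos _).le)
    rw [mul_pow, ← Real.exp_nat_mul]
    congr 2
    push_cast
    ring
  refine ⟨hγ, hdecay, ?_⟩
  have hexp : Tendsto (fun t : ℝ => normH1 a b (fun x => u₀ x - ‖H‖⁻¹ • H) *
      Real.exp (-(1 / 2) * decayRate α β H * t)) atTop (𝓝 0) := by
    have h1 : Tendsto (fun t : ℝ => 1 / 2 * decayRate α β H * t) atTop atTop :=
      tendsto_id.const_mul_atTop (by positivity)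
    have h2 := (Real.tendsto_exp_neg_atTop_nhds_zero.comp h1).const_mul
      (normH1 a b (fun x => u₀ x - ‖H‖⁻¹ • H))
    rw [mul_zero] at h2
    refine h2.congr fun t => ?_
    simp only [Function.comp_apply]
    congr 2
    ring
  exact squeeze_zero' (Eventually.of_forall fun _ => Real.sqrt_nonneg _)
    ((eventually_ge_atTop 0).mono hdecay) hexp
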